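/- Fix $d\in\{2,3\}$. A damped network consists of finitely many nodes at distinct points of $\mathbb R^d$, split into terminal nodes $x_1,\dots,x_n$ (index set $B$) and internal nodes (index set $I$, possibly empty), together with spring constants $k_{ij}=k_{ji}\ge 0$ and damper constants $c_{ij}=c_{ji}\ge 0$ for pairs of nodes, and node masses $m_i\ge 0$ and viscous coefficients $v_i\ge 0$. With $n_{ij}$ the unit vector in the direction of the difference of the positions of nodes $i$ and $j$, and $N_{ij}=\big((e_i-e_j)(e_i-e_j)^T\big)\otimes\big(n_{ij}n_{ij}^T\big)$, put $K=\sum_{\{i,j\}}k_{ij}N_{ij}$, $C=\sum_{\{i,j\}}c_{ij}N_{ij}+\mathrm{diag}(v_i I_d)$ and $M=\mathrm{diag}(m_iI_d)$. The network is massless if all $m_i=0$; it has Rayleigh damping with constants $\alpha,\beta\ge 0$ if $C=\alpha K+\beta M$; it is static if it consists of springs only ($c_{ij}=v_i=m_i=0$). Its response is the matrix-valued function $F(\lambda)$ of the Laplace parameter $\lambda\in\mathbb C$ with the following property: for all terminal displacements $u_B$ and terminal forces $f_B$, there are internal displacements $u_I$ with $(K+\lambda C+\lambda^2M)\binom{u_B}{u_I}=\binom{f_B}{0}$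 if and only if $f_B=F(\lambda)u_B$. (When the $II$ block of $K+\lambda C+\lambda^2M$ is invertible, $F(\lambda)$ is the Schur complement of this block.) Forces $f_1,\dots,f_n\in\mathbb R^d$ at $x_1,\dots,x_n$ are balanced if $\sum_i f_i=0$ and $\sum_i x_i\times f_i=0$. Theorem. Let $x_1,\dots,x_n\in\mathbb R^d$ be distinct and let $\alpha,\beta\ge 0$. (1) The response of every massless network with terminals $x_1,\dots,x_n$ and Rayleigh damping with constants $\alpha,\beta$ is of the form $(1+\alpha\lambda)W$ for all $\lambda\in\mathbb C$, where $W$ is the response of a static network with terminals $x_1,\dots,x_n$; moreover $W$ is a real symmetric positive semidefinite $nd\times nd$ matrix each of whose columns is a balanced system of forces at $x_1,\dots,x_n$. (2) Conversely, let $W$ be a real symmetric positive semidefinite $nd\times nd$ matrix each of whose columns is a balanced system of forces at $x_1,\dots,x_n$. Then for every finite set $S\subset\mathbb R^d$ and every $\varepsilon>0$ there is a massless network with terminals $x_1,\dots,x_n$ and Rayleigh damping with constants $\alpha,\beta$, in which moreover $c_{ij}=\alpha k_{ij}$ for all $i,j$, whose response is $(1+\alpha\lambda)W$ for all $\lambda\in\mathbb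 C$, and whose internal nodes all avoid $S$ and lie in the $\varepsilon$-neighborhood of the convex hull of $\{x_1,\dots,x_n\}$. -/

import Mathlib

open scoped Kronecker

noncomputable section

/-- The data of a network of springs, dampers and masses in `ℝᵈ`, with `n` terminal nodes and
`m` internal nodes, placed at distinct points. For nodes `i`, `j`, the number `stiff i j` is the
spring constant of the spring joining them (zero if there is none) and `damp i j` is the damping
constant of the damper joining them (zero if there is none). Each node `i` has a mass `mass i`,
and `visc i` is the viscous damping coefficient of the cavity that surrounds it. -/
structure DampedNetwork (d n m : ℕ) where
  /-- positions of the terminal (`Sum.inl`) and internal (`Sum.inr`) nodes -/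
  pos : Fin n ⊕ Fin m → EuclideanSpace ℝ (Fin d)
  pos_injective : Function.Injective pos
  stiff : Fin n ⊕ Fin m → Fin n ⊕ Fin m → ℝ
  stiff_symm : ∀ i j, stiff i j = stiff j i
  stiff_nonneg : ∀ i j, 0 ≤ stiff i j
  damp : Fin n ⊕ Fin m → Fin n ⊕ Fin m → ℝ
  damp_symm : ∀ i j, damp i j = damp j i
  damp_nonneg : ∀ i j, 0 ≤ damp i j
  visc : Fin n ⊕ Fin m → ℝ
  visc_nonneg : ∀ i, 0 ≤ visc i
  mass : Fin n ⊕ Fin m → ℝ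
  mass_nonneg : ∀ i, 0 ≤ mass i

namespace DampedNetwork

variable {d n m : ℕ} (net : DampedNetwork d n m)

/-- The positions of the terminal nodes. -/
def terminal (i : Fin n) : EuclideanSpace ℝ (Fin d) := net.pos (Sum.inl i)

/-- The positions of the internal nodes. -/
def internal (j : Fin m) : EuclideanSpace ℝ (Fin d) := net.pos (Sum.inr j)

/-- The unit vector with the direction of `xᵢ - xⱼ` (zero if `i = j`). -/
def unitVec (i j : Fin n ⊕ Fin m) : EuclideanSpace ℝ (Fin d) :=
  (‖net.pos i - net.pos j‖)⁻¹ • (net.pos i - net.pos j)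

/-- The matrix `((eᵢ - eⱼ)(eᵢ - eⱼ)ᵀ) ⊗ (nᵢⱼ nᵢⱼᵀ)`, the contribution of a spring or damper of
unit constant joining the nodes `i` and `j`. -/
def springMat (i j : Fin n ⊕ Fin m) :
    Matrix ((Fin n ⊕ Fin m) × Fin d) ((Fin n ⊕ Fin m) × Fin d) ℝ :=
  Matrix.vecMulVec (Pi.single i 1 - Pi.single j 1) (Pi.single i 1 - Pi.single j 1) ⊗ₖ
    Matrix.vecMulVec (net.unitVec i j).ofLp (net.unitVec i j).ofLp

/-- The stiffness matrix. The sum runs over ordered pairs, so that each spring is met twice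
(the terms with `i = j` vanish); hence the factor `1 / 2`. -/
def stiffnessMatrix : Matrix ((Fin n ⊕ Fin m) × Fin d) ((Fin n ⊕ Fin m) × Fin d) ℝ :=
  (1 / 2 : ℝ) • ∑ i, ∑ j, net.stiff i j • net.springMat i j

/-- The damping matrix: the contributions of the dampers that join nodes and of the cavities. -/
def dampingMatrix : Matrix ((Fin n ⊕ Fin m) × Fin d) ((Fin n ⊕ Fin m) × Fin d) ℝ :=
  (1 / 2 : ℝ) • ∑ i, ∑ j, net.damp i j • net.springMat i j +
    Matrix.diagonal fun p => net.visc p.1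

/-- The (diagonal) mass matrix. -/
def massMatrix : Matrix ((Fin n ⊕ Fin m) × Fin d) ((Fin n ⊕ Fin m) × Fin d) ℝ :=
  Matrix.diagonal fun p => net.mass p.1

/-- The matrix `K + s C + s² M` at the Laplace parameter `s`. -/
def dynMatrix (s : ℂ) : Matrix ((Fin n ⊕ Fin m) × Fin d) ((Fin n ⊕ Fin m) × Fin d) ℂ :=
  net.stiffnessMatrix.map Complex.ofReal + s • net.dampingMatrix.map Complex.ofReal +
    s ^ 2 • net.massMatrix.map Complex.ofReal

/-- The network is massless. -/
def IsMassless : Prop := ∀ i, net.mass i = 0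

/-- Rayleigh damping with proportionality constants `α` and `β`: `C = α K + β M`. -/
def IsRayleigh (α β : ℝ) : Prop :=
  net.dampingMatrix = α • net.stiffnessMatrix + β • net.massMatrix

/-- The network consists of springs only. -/
def IsStatic : Prop :=
  (∀ i j, net.damp i j = 0) ∧ (∀ i, net.visc i = 0) ∧ ∀ i, net.mass i = 0

end DampedNetwork

/-- The vector over all nodes with the components `u` at the terminals and `w` at the internal
nodes. -/
def joinNodes {d n m : ℕ} (u : Fin n × Fin d → ℂ) (w : Fin m × Fin d → ℂ) :
    (Fin n ⊕ Fin m) × Fin d → ℂ :=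
  fun p => Sum.elim (fun i => u (i, p.2)) (fun j => w (j, p.2)) p.1

namespace DampedNetwork

variable {d n m : ℕ} (net : DampedNetwork d n m)

/-- `F` is the displacement-to-forces map at the terminals at the Laplace parameter `s`: for
displacements `u` of the terminals, the forces `f` at the terminals that are compatible with
Newton's law, for some displacements `w` of the internal nodes and no external forces at these
nodes, are exactly `f = F u`. If the internal block of `K + s C + s² M` is invertible, this says
that `F` is the Schur complement of that block (`isResponseAt_iff_schur`); it also covers
networks with floppy internal nodes, where that block is singular and its inverse has to be
replaced by a pseudoinverse. -/
def IsResponseAt (s : ℂ) (F : Matrix (Fin n × Fin d) (Fin n × Fin d) ℂ) : Prop :=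
  ∀ u f : Fin n × Fin d → ℂ,
    (∃ w : Fin m × Fin d → ℂ,
      (net.dynMatrix s).mulVec (joinNodes u w) = joinNodes f 0) ↔ f = F.mulVec u

/-- The matrix-valued function `F` of the Laplace parameter is the response of the network at
its terminals, at every value of the parameter. -/
def HasResponse (F : ℂ → Matrix (Fin n × Fin d) (Fin n × Fin d) ℂ) : Prop :=
  ∀ s : ℂ, net.IsResponseAt s (F s)

/-- The block `BB` of a matrix over all nodes (`B`: terminals, `I`: internal nodes). -/
def blockBB (A : Matrix ((Fin n ⊕ Fin m) × Fin d) ((Fin n ⊕ Fin m) × Fin d) ℂ) :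
    Matrix (Fin n × Fin d) (Fin n × Fin d) ℂ :=
  A.submatrix (Prod.map Sum.inl id) (Prod.map Sum.inl id)

/-- The block `BI` of a matrix over all nodes. -/
def blockBI (A : Matrix ((Fin n ⊕ Fin m) × Fin d) ((Fin n ⊕ Fin m) × Fin d) ℂ) :
    Matrix (Fin n × Fin d) (Fin m × Fin d) ℂ :=
  A.submatrix (Prod.map Sum.inl id) (Prod.map Sum.inr id)

/-- The block `IB` of a matrix over all nodes. -/
def blockIB (A : Matrix ((Fin n ⊕ Fin m) × Fin d) ((Fin n ⊕ Fin m) × Fin d) ℂ) :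
    Matrix (Fin m × Fin d) (Fin n × Fin d) ℂ :=
  A.submatrix (Prod.map Sum.inr id) (Prod.map Sum.inl id)

/-- The block `II` of a matrix over all nodes. -/
def blockII (A : Matrix ((Fin n ⊕ Fin m) × Fin d) ((Fin n ⊕ Fin m) × Fin d) ℂ) :
    Matrix (Fin m × Fin d) (Fin m × Fin d) ℂ :=
  A.submatrix (Prod.map Sum.inr id) (Prod.map Sum.inr id)

theorem mulVec_joinNodes
    (A : Matrix ((Fin n ⊕ Fin m) × Fin d) ((Fin n ⊕ Fin m) × Fin d) ℂ)
    (u : Fin n × Fin d → ℂ) (w : Fin m × Fin d → ℂ) :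
    A.mulVec (joinNodes u w) =
      joinNodes ((blockBB A).mulVec u + (blockBI A).mulVec w)
        ((blockIB A).mulVec u + (blockII A).mulVec w) := by
  ext ⟨i | i, a⟩ <;>
    simp [Matrix.mulVec, dotProduct, joinNodes, Fintype.sum_prod_type, Fintype.sum_sum_type,
      blockBB, blockBI, blockIB, blockII]

theorem joinNodes_inj {u u' : Fin n × Fin d → ℂ} {w w' : Fin m × Fin d → ℂ} :
    joinNodes u w = joinNodes u' w' ↔ u = u' ∧ w = w' := by
  constructor
  · intro h
    refine ⟨funext fun p => ?_, funext fun p => ?_⟩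
    · simpa [joinNodes] using congrFun h (Sum.inl p.1, p.2)
    · simpa [joinNodes] using congrFun h (Sum.inr p.1, p.2)
  · rintro ⟨rfl, rfl⟩
    rfl

/-- Away from resonances the response is given by the Schur complement of the internal block. -/
theorem isResponseAt_iff_schur (s : ℂ) (F : Matrix (Fin n × Fin d) (Fin n × Fin d) ℂ)
    (h : IsUnit (blockII (net.dynMatrix s)).det) :
    net.IsResponseAt s F ↔
      F = blockBB (net.dynMatrix s) - blockBI (net.dynMatrix s) *
        (blockII (net.dynMatrix s))⁻¹ * blockIB (net.dynMatrix s) := by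
  have key : ∀ u f : Fin n × Fin d → ℂ,
      (∃ w : Fin m × Fin d → ℂ,
        (net.dynMatrix s).mulVec (joinNodes u w) = joinNodes f 0) ↔
      f = (blockBB (net.dynMatrix s) - blockBI (net.dynMatrix s) *
        (blockII (net.dynMatrix s))⁻¹ * blockIB (net.dynMatrix s)).mulVec u := by
    intro u f
    simp only [mulVec_joinNodes, joinNodes_inj]
    generalize blockBB (net.dynMatrix s) = A at *
    generalize blockBI (net.dynMatrix s) = P at *
    generalize blockIB (net.dynMatrix s) = Q at *
    generalize blockII (net.dynMatrix s) = D at *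
    constructor
    · rintro ⟨w, h1, h2⟩
      have hw : w = -(D⁻¹.mulVec (Q.mulVec u)) := by
        have h3 := congrArg D⁻¹.mulVec (eq_neg_of_add_eq_zero_right h2)
        rw [Matrix.mulVec_mulVec, Matrix.nonsing_inv_mul _ h, Matrix.one_mulVec,
          Matrix.mulVec_neg] at h3
        exact h3
      rw [← h1, hw, Matrix.sub_mulVec, Matrix.mulVec_neg, ← Matrix.mulVec_mulVec,
        ← Matrix.mulVec_mulVec, sub_eq_add_neg]
    · rintro rfl
      refine ⟨-(D⁻¹.mulVec (Q.mulVec u)), ?_, ?_⟩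
      · rw [Matrix.sub_mulVec, Matrix.mulVec_neg, ← Matrix.mulVec_mulVec,
          ← Matrix.mulVec_mulVec, sub_eq_add_neg]
      · rw [Matrix.mulVec_neg, Matrix.mulVec_mulVec, Matrix.mul_nonsing_inv _ h,
          Matrix.one_mulVec, add_neg_cancel]
  constructor
  · intro hF
    refine Matrix.ext_of_mulVec_single fun p => ?_
    exact (key _ _).1 ((hF _ _).2 rfl)
  · rintro rfl u f
    exact key u f

end DampedNetwork

/-- The real matrix `W` is the response at the terminals `x` of a static network, that is, of a
network that consists of springs only. -/
def IsStaticResponse {d n : ℕ} (x : Fin n → EuclideanSpace ℝ (Fin d))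
    (W : Matrix (Fin n × Fin d) (Fin n × Fin d) ℝ) : Prop :=
  ∃ (m : ℕ) (net : DampedNetwork d n m), net.terminal = x ∧ net.IsStatic ∧
    net.HasResponse fun _ => W.map Complex.ofReal

/-- The forces `fᵢ = (g (i, a))ₐ` at the points `xᵢ` are a balanced system of forces: their sum
vanishes, and so does the sum of the torques `xᵢ ∧ fᵢ`. The components of the latter are those of
the usual cross product in dimensions 2 and 3 (`isBalanced_two`, `isBalanced_three`). -/
def IsBalanced {d n : ℕ} (x : Fin n → EuclideanSpace ℝ (Fin d)) (g : Fin n × Fin d → ℝ) : Prop :=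
  (∀ a, ∑ i, g (i, a) = 0) ∧
    ∀ a b, ∑ i, (x i a * g (i, b) - x i b * g (i, a)) = 0

theorem isBalanced_two {n : ℕ} (x : Fin n → EuclideanSpace ℝ (Fin 2)) (g : Fin n × Fin 2 → ℝ) :
    IsBalanced x g ↔ (∑ i, (fun a => g (i, a))) = 0 ∧
      ∑ i, (x i 0 * g (i, 1) - x i 1 * g (i, 0)) = 0 := by
  simp only [IsBalanced, funext_iff, Finset.sum_apply, Pi.zero_apply, Fin.forall_fin_two,
    Finset.sum_sub_distrib]
  grind

theorem isBalanced_three {n : ℕ} (x : Fin n → EuclideanSpace ℝ (Fin 3)) (g : Fin n × Fin 3 → ℝ) :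
    IsBalanced x g ↔ (∑ i, (fun a => g (i, a))) = 0 ∧
      ∑ i, crossProduct (x i).ofLp (fun a => g (i, a)) = 0 := by
  simp only [IsBalanced, funext_iff, Finset.sum_apply, Pi.zero_apply, Fin.forall_fin_succ,
    cross_apply, Finset.sum_sub_distrib, IsEmpty.forall_iff, Fin.succ_zero_eq_one,
    Fin.succ_one_eq_two, Matrix.cons_val]
  simp only [Fin.isValue, and_true, sub_self, true_and]
  constructor
  · rintro ⟨h, h1, h2, h3⟩
    refine ⟨h, ?_, ?_, ?_⟩ <;> linarith
  · rintro ⟨h, h1, h2, h3⟩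
    refine ⟨h, ⟨?_, ?_⟩, ⟨?_, ?_⟩, ?_, ?_⟩ <;> linarith

end

set_option linter.unusedSectionVars false

/-! Without masses, Rayleigh damping means `C = αK`, so `K + λC = (1 + αλ)K` and only the static
response of `K` matters. As `K` is positive semidefinite, the internal nodes have an equilibrium for
all terminal displacements, and internal floppy modes carry no force. Hence the static response
exists; it equals `PᵀKP`, where the columns of `P` are equilibrium states, and it is balanced
because the force pair of each spring is.

Conversely, write `W = GᵀG`. The rows of `G` are balanced since `ker W = ker G`, and networks that
share only terminals add their responses, so it suffices to realise `g gᵀ` for a balanced `g`. One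
seeks springs whose terminal forces, with no force at internal nodes, form exactly the line `ℝ g`
(`IsSupportable`). The response to `u` is then `a g`, and reciprocity makes `a` proportional to `g ·
u`; rescaling the spring constants gives `(g · u) g` (`IsSupportable.isSynthesizable`). Only the
line matters, not the signs of the tensions, so positive constants are no restriction.

To support `ℝ g` alone, duality and infinitesimal rigidity first show that `g` is a combination of
spring forces among the terminals and a few nearby points (`exists_mem_springSpan_of_balanced`).
These springs must then be made to act in a fixed ratio. A gadget of seven springs couples two
springs with a common endpoint; a chain of gadgets through a generic point couples two springs in
general position or not; a dummy spring `cd`, subdivided at each step, lets an induction couple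
arbitrarily many. A genuine spring `cd` finally absorbs the dummy force, and the auxiliary points
become internal. -/

noncomputable section

/-! ### Spring forces and the forces that a set of springs can support -/

section Springs

variable {V : Type*} [NormedAddCommGroup V] [InnerProductSpace ℝ V]

open Classical in
/-- The force field of a spring joining `p` and `q`, normalised by the distance of these points. -/
def springForce (p q : V) : V → V := Pi.single p (p - q) + Pi.single q (q - p)

/-- The force fields that vanish outside of `S`. -/
def supportedIn (S : Set V) : Submodule ℝ (V → V) where
  carrier := {v | ∀ z, z ∉ S → v z = 0}
  add_mem' ha hb z hz := by simp [ha z hz, hb z hz]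
  zero_mem' _ _ := rfl
  smul_mem' c a ha z hz := by simp [ha z hz]

theorem supportedIn_mono {S S' : Set V} (h : S ⊆ S') : supportedIn S ≤ supportedIn S' :=
  fun _ hv z hz => hv z fun hz' => hz (h hz')

theorem springForce_mem_supportedIn {p q : V} {S : Set V} (hp : p ∈ S) (hq : q ∈ S) :
    springForce p q ∈ supportedIn S := by
  intro z hz
  have h1 : z ≠ p := fun h => hz (h ▸ hp)
  have h2 : z ≠ q := fun h => hz (h ▸ hq)
  simp [springForce, h1, h2]

theorem springForce_comm (p q : V) : springForce p q = springForce q p := by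
  simp [springForce, add_comm]

/-- The force fields of the springs along the edges of `E`. -/
def springSpan (E : Set (V × V)) : Submodule ℝ (V → V) :=
  Submodule.span ℝ ((fun e => springForce e.1 e.2) '' E)

theorem springSpan_le_supportedIn {E : Set (V × V)} {S : Set V}
    (h : ∀ e ∈ E, e.1 ∈ S ∧ e.2 ∈ S) : springSpan E ≤ supportedIn S := by
  refine Submodule.span_le.2 ?_
  rintro _ ⟨e, he, rfl⟩
  exact springForce_mem_supportedIn (h e he).1 (h e he).2

/-- For each finite set `S` of forbidden points, there is a finite set of springs with internal
nodes in `U \ S` such that the external forces at `T` that the springs can support are those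
in `H`. -/
def IsSupportable (U T : Set V) (H : Submodule ℝ (V → V)) : Prop :=
  ∀ S : Set V, S.Finite → ∃ E : Set (V × V), E.Finite ∧
    (∀ e ∈ E, e.1 ≠ e.2 ∧ e.1 ∈ T ∪ U \ S ∧ e.2 ∈ T ∪ U \ S) ∧
    springSpan E ⊓ supportedIn (S ∪ T) = H

variable {U T T' : Set V} {H H₁ H₂ : Submodule ℝ (V → V)}

theorem IsSupportable.le_supportedIn (h : IsSupportable U T H) : H ≤ supportedIn T := by
  obtain ⟨E, -, -, rfl⟩ := h ∅ Set.finite_empty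
  simp

theorem IsSupportable.mono (h : IsSupportable U T H) (hT' : T'.Finite) (hT : T ⊆ T') :
    IsSupportable U T' H := by
  intro S hS
  obtain ⟨E, hE, hE', hH⟩ := h (S ∪ T') (hS.union hT')
  refine ⟨E, hE, fun e he => ?_, ?_⟩
  · obtain ⟨h1, h2, h3⟩ := hE' e he
    have : T ∪ U \ (S ∪ T') ⊆ T' ∪ U \ S :=
      Set.union_subset_union hT (Set.sdiff_subset_sdiff_right Set.subset_union_left)
    exact ⟨h1, this h2, this h3⟩
  · rw [← hH, Set.union_assoc S T' T, Set.union_eq_self_of_subset_right hT]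

theorem isSupportable_springSpan {E : Set (V × V)} (hE : E.Finite)
    (h : ∀ e ∈ E, e.1 ≠ e.2 ∧ e.1 ∈ T ∧ e.2 ∈ T) : IsSupportable U T (springSpan E) := by
  intro S hS
  refine ⟨E, hE, fun e he => ⟨(h e he).1, Or.inl (h e he).2.1, Or.inl (h e he).2.2⟩, ?_⟩
  exact inf_eq_left.2 (springSpan_le_supportedIn fun e he =>
    ⟨Or.inr (h e he).2.1, Or.inr (h e he).2.2⟩)

theorem springSpan_union (E E' : Set (V × V)) :
    springSpan (E ∪ E') = springSpan E ⊔ springSpan E' := by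
  simp [springSpan, Set.image_union, Submodule.span_union]

/-- The second set of springs avoids the nodes of the first outside `T`. At an internal node only
one of the two sets acts, so equilibrium of the sum is equilibrium of each summand. -/
theorem IsSupportable.sup (h₁ : IsSupportable U T H₁) (h₂ : IsSupportable U T H₂)
    (hT : T.Finite) : IsSupportable U T (H₁ ⊔ H₂) := by
  intro S hS
  obtain ⟨E₁, hE₁, hE₁', hH₁⟩ := h₁ (S ∪ T) (hS.union hT)
  set N : Set V := Prod.fst '' E₁ ∪ Prod.snd '' E₁ with hN
  have hNf : N.Finite := (hE₁.image _).union (hE₁.image _)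
  obtain ⟨E₂, hE₂, hE₂', hH₂⟩ := h₂ (S ∪ T ∪ N) ((hS.union hT).union hNf)
  have hs₁ : springSpan E₁ ≤ supportedIn N := springSpan_le_supportedIn fun e he =>
    ⟨Or.inl ⟨e, he, rfl⟩, Or.inr ⟨e, he, rfl⟩⟩
  refine ⟨E₁ ∪ E₂, hE₁.union hE₂, ?_, ?_⟩
  · rintro e (he | he)
    · obtain ⟨h1, h2, h3⟩ := hE₁' e he
      have : T ∪ U \ (S ∪ T) ⊆ T ∪ U \ S := by grind
      exact ⟨h1, this h2, this h3⟩
    · obtain ⟨h1, h2, h3⟩ := hE₂' e he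
      have : T ∪ U \ (S ∪ T ∪ N) ⊆ T ∪ U \ S := by grind
      exact ⟨h1, this h2, this h3⟩
  · apply le_antisymm
    · rintro v ⟨hv, hv'⟩
      rw [SetLike.mem_coe, springSpan_union] at hv
      obtain ⟨v₁, hv₁, v₂, hv₂, rfl⟩ := Submodule.mem_sup.1 hv
      -- Outside `N` the field `v₁` vanishes, so `v₂` is balanced there. Once `v₂ ∈ H₂` is known to
      -- vanish outside `T`, the same holds for `v₁`.
      have h2 : v₂ ∈ H₂ := by
        rw [← hH₂]
        refine ⟨hv₂, fun z hz => ?_⟩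
        have h3 := hv' z (by grind)
        have h4 := hs₁ hv₁ z (by grind)
        simpa [h4] using h3
      have h1 : v₁ ∈ H₁ := by
        rw [← hH₁]
        refine ⟨hv₁, fun z hz => ?_⟩
        have h3 := hv' z (by grind)
        have h4 := h₂.le_supportedIn h2 z (by grind)
        simpa [h4] using h3
      exact Submodule.add_mem_sup h1 h2
    · refine le_inf ?_ ?_
      · rw [springSpan_union]
        exact sup_le_sup (hH₁ ▸ inf_le_left) (hH₂ ▸ inf_le_left)
      · exact sup_le (h₁.le_supportedIn.trans (supportedIn_mono Set.subset_union_right))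
          (h₂.le_supportedIn.trans (supportedIn_mono Set.subset_union_right))

/-- Nodes in `U` can be made internal. -/
theorem IsSupportable.of_elimination (hT : T.Finite)
    (h : ∀ S : Set V, S.Finite → ∃ (Y : Set V) (H' : Submodule ℝ (V → V)), Y ⊆ U \ S ∧
      Y.Finite ∧ IsSupportable U (T ∪ Y) H' ∧ H' ⊓ supportedIn T = H) :
    IsSupportable U T H := by
  intro S hS
  obtain ⟨Y, H', hY, hYf, hH', rfl⟩ := h (S ∪ T) (hS.union hT)
  obtain ⟨E, hE, hE', hH⟩ := hH' S hS
  refine ⟨E, hE, fun e he => ?_, ?_⟩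
  · obtain ⟨h1, h2, h3⟩ := hE' e he
    have : T ∪ Y ∪ U \ S ⊆ T ∪ U \ S := by grind
    exact ⟨h1, this h2, this h3⟩
  · apply le_antisymm
    · rintro v ⟨hv, hv'⟩
      have hv1 : v ∈ H' := hH ▸ ⟨hv, fun z hz => hv' z (by grind)⟩
      refine ⟨hv1, fun z hz => ?_⟩
      by_cases hz' : z ∈ S
      · exact hH'.le_supportedIn hv1 z (by grind)
      · exact hv' z (by grind)
    · rintro v ⟨hv, hv'⟩
      rw [SetLike.mem_coe, ← hH] at hv
      exact ⟨hv.1, supportedIn_mono Set.subset_union_right hv'⟩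

theorem span_singleton_inf_supportedIn {g : V → V} (hg : g ∈ supportedIn T) :
    Submodule.span ℝ {g} ⊓ supportedIn T = Submodule.span ℝ {g} :=
  inf_eq_left.2 ((Submodule.span_singleton_le_iff_mem _ _).2 hg)

theorem isSupportable_spring {p q : V} (hpq : p ≠ q) (hp : p ∈ T) (hq : q ∈ T) {c : ℝ}
    (hc : c ≠ 0) : IsSupportable U T (Submodule.span ℝ {c • springForce p q}) := by
  have := isSupportable_springSpan (U := U) (T := T) (E := {(p, q)}) (Set.finite_singleton _)
    (by simp [hpq, hp, hq])
  rw [Submodule.span_singleton_smul_eq (IsUnit.mk0 c hc)]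
  simpa [springSpan] using this

/-- With a single vector `w` at both ends, identities of force fields become identities between
coefficients of `Pi.single`. -/
theorem springForce_eq_of_sub {p q w : V} (h : p - q = w) :
    springForce p q = by classical exact Pi.single p w - Pi.single q w := by
  subst h
  simp [springForce, ← Pi.single_neg, sub_eq_add_neg]

theorem eventually_mem_diff_of_tendsto {ι : Type*} {l : Filter ι} {f : ι → V} {x₀ : V}
    (hf : Filter.Tendsto f l (nhds x₀)) (hne : ∀ᶠ t in l, f t ≠ x₀) (hU : IsOpen U)
    (hx₀ : x₀ ∈ U) {S : Set V} (hS : S.Finite) : ∀ᶠ t in l, f t ∈ U \ S := by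
  have h1 : U ∩ (S \ {x₀})ᶜ ∈ nhds x₀ :=
    (hU.inter (hS.subset Set.sdiff_subset).isClosed.isOpen_compl).mem_nhds ⟨hx₀, by simp⟩
  filter_upwards [hf h1, hne] with t ht ht'
  exact ⟨ht.1, fun h => ht.2 ⟨h, ht'⟩⟩

end Springs

/-! ### The gadget that couples two springs with a common endpoint -/

section Coupling

variable {V : Type*} [NormedAddCommGroup V] [InnerProductSpace ℝ V]

theorem springForce_apply_left {p q : V} (h : p ≠ q) : springForce p q p = p - q := by
  simp [springForce, h]

theorem springForce_apply_right {p q : V} (h : p ≠ q) : springForce p q q = q - p := by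
  simp [springForce, h.symm]

theorem springForce_apply_of_ne {p q z : V} (hp : z ≠ p) (hq : z ≠ q) :
    springForce p q z = 0 := by
  simp [springForce, hp, hq]

variable {U T : Set V}

/-- Springs along the edges of a bent quadrilateral transmit the forces of two springs with
a common endpoint, with a fixed ratio. -/
theorem springSpan_inf_supportedIn_of_quadrilateral {p q r p' a b : V} {A B₁ B₂ : ℝ}
    (hp : p ∈ T) (hq : q ∈ T) (hr : r ∈ T) (hind : LinearIndependent ℝ ![q - p, r - p])
    (hA : A ≠ 0) (hB₁ : B₁ ≠ 0) (hB₂ : B₂ ≠ 0) (hB₂1 : B₂ ≠ 1)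
    (hp' : p' = p + A⁻¹ • (q - p)) (ha : a = p + B₁⁻¹ • (r - p)) (hb : b = p + B₂⁻¹ • (r - p))
    (hp'T : p' ∉ T) (haT : a ∉ T) (hbT : b ∉ T) (hpa : p' ≠ a) (hpb : p' ≠ b) (hab : a ≠ b) :
    springSpan {(p', p), (p', a), (p', b), (q, a), (q, b), (a, p), (b, r)} ⊓ supportedIn T =
      Submodule.span ℝ {(B₂ - B₁) • springForce p q + (1 - A) • springForce p r} := by
  classical
  obtain ⟨u, hu⟩ : ∃ u, u = q - p := ⟨_, rfl⟩
  obtain ⟨v, hv⟩ : ∃ v, v = r - p := ⟨_, rfl⟩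
  rw [← hu, ← hv, LinearIndependent.pair_iff] at hind
  have hq0 : q = p + u := by rw [hu]; abel
  have hr0 : r = p + v := by rw [hv]; abel
  rw [← hu] at hp'
  rw [← hv] at ha hb
  have hw : B₂⁻¹ - 1 ≠ 0 := by
    intro h
    have : B₂⁻¹ = 1 := by linarith
    exact hB₂1 (inv_eq_one.1 this)
  -- These seven tensions solve the equilibrium equations at `p'`, `a` and `b`. Those are six scalar
  -- equations in the coordinates `u`, `v`, and the converse below shows that they fix the tensions
  -- up to a factor.
  have hid : (B₂ - B₁) • springForce p q + (1 - A) • springForce p r =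
      (-A * (B₁ - B₂)) • springForce p' p + (A * B₁) • springForce p' a +
      (-A * B₂) • springForce p' b + (-B₁) • springForce q a + B₂ • springForce q b +
      (-B₁ * (A - 1)) • springForce a p + ((A - 1) / (B₂⁻¹ - 1)) • springForce b r := by
    rw [springForce_eq_of_sub (p := p) (q := q) (w := - (1 : ℝ) • u) (by rw [hq0]; module),
      springForce_eq_of_sub (p := p) (q := r) (w := - (1 : ℝ) • v) (by rw [hr0]; module),
      springForce_eq_of_sub (p := p') (q := p) (w := A⁻¹ • u) (by rw [hp']; module),
      springForce_eq_of_sub (p := p') (q := a) (w := A⁻¹ • u - B₁⁻¹ • v)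
        (by rw [hp', ha]; module),
      springForce_eq_of_sub (p := p') (q := b) (w := A⁻¹ • u - B₂⁻¹ • v)
        (by rw [hp', hb]; module),
      springForce_eq_of_sub (p := q) (q := a) (w := u - B₁⁻¹ • v) (by rw [hq0, ha]; module),
      springForce_eq_of_sub (p := q) (q := b) (w := u - B₂⁻¹ • v) (by rw [hq0, hb]; module),
      springForce_eq_of_sub (p := a) (q := p) (w := B₁⁻¹ • v) (by rw [ha]; module),
      springForce_eq_of_sub (p := b) (q := r) (w := (B₂⁻¹ - 1) • v) (by rw [hr0, hb]; module)]
    simp only [Pi.single_sub, Pi.single_smul]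
    match_scalars <;> field_simp <;> ring
  have ne1 : p' ≠ p := fun h => hp'T (h ▸ hp)
  have ne2 : p' ≠ q := fun h => hp'T (h ▸ hq)
  have ne3 : p' ≠ r := fun h => hp'T (h ▸ hr)
  have ne4 : a ≠ p := fun h => haT (h ▸ hp)
  have ne5 : a ≠ q := fun h => haT (h ▸ hq)
  have ne6 : a ≠ r := fun h => haT (h ▸ hr)
  have ne7 : b ≠ p := fun h => hbT (h ▸ hp)
  have ne8 : b ≠ q := fun h => hbT (h ▸ hq)
  have ne9 : b ≠ r := fun h => hbT (h ▸ hr)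
  apply le_antisymm
  · rintro f ⟨hf, hfT⟩
    simp only [springSpan, Set.image_insert_eq, Set.image_singleton, SetLike.mem_coe,
      Submodule.mem_span_insert, Submodule.mem_span_singleton] at hf
    obtain ⟨c₁, _, ⟨c₂, _, ⟨c₃, _, ⟨c₄, _, ⟨c₅, _, ⟨c₆, _, ⟨c₇, rfl⟩, rfl⟩, rfl⟩, rfl⟩, rfl⟩,
      rfl⟩, rfl⟩ := hf
    have e1 := hfT p' hp'T
    have e2 := hfT a haT
    have e3 := hfT b hbT
    simp only [Pi.add_apply, Pi.smul_apply, springForce_apply_left ne1, springForce_apply_left hpa,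
      springForce_apply_left hpb, springForce_apply_of_ne ne2 hpa, springForce_apply_of_ne ne2 hpb,
      springForce_apply_of_ne hpa ne1, springForce_apply_of_ne hpb ne3] at e1
    simp only [Pi.add_apply, Pi.smul_apply, springForce_apply_of_ne hpa.symm ne4,
      springForce_apply_right hpa, springForce_apply_of_ne hpa.symm hab,
      springForce_apply_right ne5.symm, springForce_apply_of_ne ne5 hab,
      springForce_apply_left ne4, springForce_apply_of_ne hab ne6] at e2
    simp only [Pi.add_apply, Pi.smul_apply, springForce_apply_of_ne hpb.symm ne7,
      springForce_apply_of_ne hpb.symm hab.symm, springForce_apply_right hpb,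
      springForce_apply_of_ne ne8 hab.symm, springForce_apply_right ne8.symm,
      springForce_apply_of_ne hab.symm ne7, springForce_apply_left ne9] at e3
    obtain ⟨e11, e12⟩ := hind (c₁ * A⁻¹ + c₂ * A⁻¹ + c₃ * A⁻¹) (- c₂ * B₁⁻¹ - c₃ * B₂⁻¹) (by
      rw [← e1, hp', ha, hb]; module)
    obtain ⟨e21, e22⟩ := hind (-c₂ * A⁻¹ - c₄) (c₂ * B₁⁻¹ + c₄ * B₁⁻¹ + c₆ * B₁⁻¹) (by
      rw [← e2, hp', ha, hq0]; module)
    obtain ⟨e31, e32⟩ := hind (-c₃ * A⁻¹ - c₅) (c₃ * B₂⁻¹ + c₅ * B₂⁻¹ + c₇ * (B₂⁻¹ - 1)) (by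
      rw [← e3, hp', hb, hr0, hq0]; module)
    rw [Submodule.mem_span_singleton]
    -- The tension `c₂` determines the others: equilibrium at `p'` gives `c₃` and `c₁`, at `a` it
    -- gives `c₄` and `c₆`, at `b` it gives `c₅` and `c₇`.
    obtain ⟨k, hk⟩ : ∃ k, k = c₂ / (A * B₁) := ⟨_, rfl⟩
    have h2 : c₂ = k * (A * B₁) := by rw [hk]; field_simp
    have h3 : c₃ = k * (-A * B₂) := by
      have : c₃ = -(c₂ * B₁⁻¹) * B₂ := by field_simp at e12 ⊢; linarith
      rw [this, h2]; field_simp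
    have h1 : c₁ = k * (-A * (B₁ - B₂)) := by
      have : c₁ = -c₂ - c₃ := by field_simp at e11; linarith
      rw [this, h2, h3]; ring
    have h4 : c₄ = k * (-B₁) := by
      have : c₄ = -c₂ * A⁻¹ := by linarith
      rw [this, h2]; field_simp
    have h5 : c₅ = k * B₂ := by
      have : c₅ = -c₃ * A⁻¹ := by linarith
      rw [this, h3]; field_simp
    have h6 : c₆ = k * (-B₁ * (A - 1)) := by
      have : c₆ = -c₂ - c₄ := by field_simp at e22; linarith
      rw [this, h2, h4]; ring
    have h7 : c₇ = k * ((A - 1) / (B₂⁻¹ - 1)) := by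
      have : c₇ = -(c₃ * B₂⁻¹ + c₅ * B₂⁻¹) / (B₂⁻¹ - 1) := by
        rw [eq_div_iff hw]; linarith
      rw [this, h3, h5, ← mul_div_assoc]
      congr 1
      field_simp
      ring
    refine ⟨k, ?_⟩
    rw [hid, h1, h2, h3, h4, h5, h6, h7]
    module
  · rw [Submodule.span_singleton_le_iff_mem]
    have key : ∀ e ∈ ({(p', p), (p', a), (p', b), (q, a), (q, b), (a, p), (b, r)} : Set (V × V)),
        ∀ c : ℝ, c • springForce e.1 e.2 ∈
        springSpan {(p', p), (p', a), (p', b), (q, a), (q, b), (a, p), (b, r)} := fun e he c =>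
      Submodule.smul_mem _ _ (Submodule.subset_span ⟨e, he, rfl⟩)
    refine ⟨?_, ?_⟩
    · rw [hid]
      refine add_mem (add_mem (add_mem (add_mem (add_mem (add_mem ?_ ?_) ?_) ?_) ?_) ?_) ?_
      · exact key (p', p) (by simp) _
      · exact key (p', a) (by simp) _
      · exact key (p', b) (by simp) _
      · exact key (q, a) (by simp) _
      · exact key (q, b) (by simp) _
      · exact key (a, p) (by simp) _
      · exact key (b, r) (by simp) _
    · exact add_mem (Submodule.smul_mem _ _ (springForce_mem_supportedIn hp hq))
        (Submodule.smul_mem _ _ (springForce_mem_supportedIn hp hr))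

-- The ratio of the two forces of the gadget depends on its parameters `A`, `B₁`, `B₂` only through
-- `B₂ - B₁` and `1 - A`. Any ratio can be kept while the parameters grow, which moves the three new
-- nodes to `p`, hence into `U` and away from `S`.
open Filter Topology in
theorem isSupportable_of_common_endpoint (hU : IsOpen U) (hT : T.Finite) {p q r : V}
    (hpU : p ∈ U) (hp : p ∈ T) (hq : q ∈ T) (hr : r ∈ T)
    (hind : LinearIndependent ℝ ![q - p, r - p]) {c c' : ℝ} (hc : c ≠ 0) (hc' : c' ≠ 0) :
    IsSupportable U T (Submodule.span ℝ {c • springForce p q + c' • springForce p r}) := by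
  refine IsSupportable.of_elimination hT fun S hS => ?_
  have hu : q - p ≠ 0 := hind.ne_zero 0
  have hv : r - p ≠ 0 := hind.ne_zero 1
  -- the points below tend to `p`
  have key : ∀ (s : ℝ) (k : ℝ), k ≠ 0 → ∀ w : V, w ≠ 0 → ∀ᶠ x : ℝ in atTop,
      s + k * x ≠ 0 ∧ s + k * x ≠ 1 ∧ p + (s + k * x)⁻¹ • w ∈ U \ (S ∪ T) := by
    intro s k hk w hw
    have hlim : Tendsto (fun x : ℝ => s + k * x) atTop (Bornology.cobounded ℝ) := by
      rcases lt_or_gt_of_ne hk with hk | hk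
      · exact (tendsto_atBot_add_const_left _ _ (tendsto_id.const_mul_atTop_of_neg hk)).mono_right
          IsOrderBornology.atBot_le_cobounded
      · exact (tendsto_atTop_add_const_left _ _ (tendsto_id.const_mul_atTop hk)).mono_right
          IsOrderBornology.atTop_le_cobounded
    have h0 : ∀ᶠ x : ℝ in atTop, s + k * x ≠ 0 :=
      hlim.eventually (Bornology.eventually_ne_cobounded 0)
    have h1 : ∀ᶠ x : ℝ in atTop, s + k * x ≠ 1 :=
      hlim.eventually (Bornology.eventually_ne_cobounded 1)
    have h2 : Tendsto (fun x : ℝ => p + (s + k * x)⁻¹ • w) atTop (𝓝 p) := by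
      have := ((tendsto_inv₀_cobounded.comp hlim).smul_const w).const_add p
      simpa using this
    filter_upwards [h0, h1, eventually_mem_diff_of_tendsto h2
      (by filter_upwards [h0] with x hx; simpa [hw] using hx) hU hpU (hS.union hT)] with x a b c
    exact ⟨a, b, c⟩
  -- With `A = 1 - c' x`, `B₁ = c x`, `B₂ = 2 c x` the gadget supports `x` times the required field,
  -- as `B₂ - B₁ = c x` and `1 - A = c' x`.
  obtain ⟨x, hx, ⟨hA0, -, hAU⟩, ⟨hB0, -, hBU⟩, ⟨hC0, hC1, hCU⟩⟩ :=
    ((eventually_ne_atTop (0 : ℝ)).and ((key 1 (-c') (neg_ne_zero.2 hc') _ hu).and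
      ((key 0 c hc _ hv).and (key 0 (2 * c) (by simpa using hc) _ hv)))).exists
  set A := 1 + -c' * x with hAdef
  set B₁ := 0 + c * x with hB₁
  set B₂ := 0 + 2 * c * x with hB₂
  have hBB : B₁ ≠ B₂ := by
    intro h
    have : c * x = 0 := by linarith
    simp_all
  have hind' := LinearIndependent.pair_iff.1 hind
  have hne : ∀ s t : ℝ, s ≠ 0 → p + s • (q - p) ≠ p + t • (r - p) := by
    intro s t hs h
    refine hs (hind' s (-t) ?_).1
    rw [neg_smul, ← sub_eq_add_neg, sub_eq_zero]
    exact add_left_cancel h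
  have hab : p + B₁⁻¹ • (r - p) ≠ p + B₂⁻¹ • (r - p) := by
    intro h
    exact hBB (inv_injective (smul_left_injective ℝ hv (add_left_cancel h)))
  have hA0' := inv_ne_zero hA0
  refine ⟨{p + A⁻¹ • (q - p), p + B₁⁻¹ • (r - p), p + B₂⁻¹ • (r - p)}, springSpan
    {(p + A⁻¹ • (q - p), p), (p + A⁻¹ • (q - p), p + B₁⁻¹ • (r - p)),
      (p + A⁻¹ • (q - p), p + B₂⁻¹ • (r - p)), (q, p + B₁⁻¹ • (r - p)), (q, p + B₂⁻¹ • (r - p)),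
      (p + B₁⁻¹ • (r - p), p), (p + B₂⁻¹ • (r - p), r)}, ?_, by simp, ?_, ?_⟩
  · rintro z (rfl | rfl | rfl)
    · exact ⟨hAU.1, fun h => hAU.2 (Or.inl h)⟩
    · exact ⟨hBU.1, fun h => hBU.2 (Or.inl h)⟩
    · exact ⟨hCU.1, fun h => hCU.2 (Or.inl h)⟩
  · have hn : ∀ y z : V, y ∈ T → z ∈ U \ (S ∪ T) → y ≠ z := by
      rintro y z hy hz rfl
      exact hz.2 (Or.inr hy)
    refine isSupportable_springSpan (by simp) ?_
    simp only [Set.mem_insert_iff, Set.mem_singleton_iff, forall_eq_or_imp, forall_eq,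
      Set.mem_union, hp, hq, hr, true_or, or_true, and_true]
    exact ⟨(hn _ _ hp hAU).symm, hne _ _ hA0', hne _ _ hA0', hn _ _ hq hBU, hn _ _ hq hCU,
      (hn _ _ hp hBU).symm, (hn _ _ hr hCU).symm⟩
  · rw [springSpan_inf_supportedIn_of_quadrilateral hp hq hr hind hA0 hB0 hC0 hC1 rfl rfl
      rfl (fun h => hAU.2 (Or.inr h)) (fun h => hBU.2 (Or.inr h)) (fun h => hCU.2 (Or.inr h))
      (hne _ _ hA0') (hne _ _ hA0') hab]
    rw [← Submodule.span_singleton_smul_eq (IsUnit.mk0 x hx) (c • _ + c' • _)]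
    congr 2
    rw [hAdef, hB₁, hB₂]
    module

end Coupling

/-! ### Coupling arbitrarily many springs -/

section Generic

variable {V : Type*} [NormedAddCommGroup V] [InnerProductSpace ℝ V] [FiniteDimensional ℝ V]

variable {U T : Set V}

open MeasureTheory in
/-- In dimension at least two, finitely many lines do not cover an open set. -/
theorem exists_mem_forall_linearIndependent (hd : 2 ≤ Module.finrank ℝ V) (hU : IsOpen U)
    (hne : U.Nonempty) {S : Set V} (hS : S.Finite) {L : Set (V × V)} (hL : L.Finite)
    (hL' : ∀ e ∈ L, e.1 ≠ e.2) :
    ∃ z ∈ U \ S, ∀ e ∈ L, LinearIndependent ℝ ![e.2 - e.1, z - e.1] := by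
  borelize V
  have : Nontrivial V := Module.nontrivial_of_finrank_pos (R := ℝ) (by omega)
  let μ : Measure V := Measure.addHaar
  let line : V × V → AffineSubspace ℝ V := fun e =>
    AffineSubspace.mk' e.1 (Submodule.span ℝ {e.2 - e.1})
  have hline : ∀ e, μ (line e : Set V) = 0 := by
    refine fun e => Measure.addHaar_affineSubspace μ _ fun h => ?_
    have h1 : Submodule.span ℝ {e.2 - e.1} = ⊤ := by
      rw [← AffineSubspace.direction_mk' e.1 (Submodule.span ℝ {e.2 - e.1})]
      exact (congrArg AffineSubspace.direction h).trans (AffineSubspace.direction_top ℝ V V)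
    have h2 := finrank_span_le_card (R := ℝ) ({e.2 - e.1} : Set V)
    rw [h1, finrank_top] at h2
    simp at h2
    omega
  have hnull : μ (S ∪ ⋃ e ∈ L, (line e : Set V)) = 0 := by
    rw [measure_union_null_iff, measure_biUnion_null_iff hL.countable]
    exact ⟨hS.measure_zero μ, fun e _ => hline e⟩
  have hpos : 0 < μ U := hU.measure_pos μ hne
  obtain ⟨z, hzU, hz⟩ : (U \ (S ∪ ⋃ e ∈ L, (line e : Set V))).Nonempty := by
    rw [Set.nonempty_iff_ne_empty]
    intro h
    exact hpos.ne' (measure_mono_null (Set.sdiff_eq_empty.1 h) hnull)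
  refine ⟨z, ⟨hzU, fun h => hz (Or.inl h)⟩, fun e he => ?_⟩
  rw [LinearIndependent.pair_iff' (sub_ne_zero.2 (hL' e he).symm)]
  intro a ha
  refine hz (Or.inr (Set.mem_biUnion he ?_))
  rw [SetLike.mem_coe, AffineSubspace.mem_mk', vsub_eq_sub]
  exact Submodule.mem_span_singleton.2 ⟨a, ha⟩

theorem mem_span_sup_span_iff {E : Type*} [AddCommGroup E] [Module ℝ E] {x y v : E} :
    v ∈ Submodule.span ℝ {x} ⊔ Submodule.span ℝ {y} ↔ ∃ a b : ℝ, a • x + b • y = v := by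
  rw [← Submodule.span_union, Set.singleton_union, Submodule.mem_span_pair]

/-- Two springs can be coupled. -/
theorem isSupportable_pair (hd : 2 ≤ Module.finrank ℝ V) (hU : IsOpen U) (hT : T.Finite)
    {p q m d : V} (hpU : p ∈ U) (hmU : m ∈ U) (hp : p ∈ T) (hq : q ∈ T) (hm : m ∈ T) (hdT : d ∈ T)
    (hpq : p ≠ q) (hmd : m ≠ d) (hpm : p ≠ m) {c c' : ℝ} (hc : c ≠ 0) (hc' : c' ≠ 0) :
    IsSupportable U T (Submodule.span ℝ {c • springForce p q + c' • springForce m d}) := by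
  refine IsSupportable.of_elimination hT fun S hS => ?_
  obtain ⟨z, ⟨hzU, hzS⟩, hz⟩ := exists_mem_forall_linearIndependent hd hU ⟨p, hpU⟩ (hS.union hT)
    (L := {(p, q), (p, m), (m, d)}) (by simp) (by simp [hpq, hpm, hmd])
  simp only [Set.mem_insert_iff, Set.mem_singleton_iff, forall_eq_or_imp, forall_eq] at hz
  obtain ⟨hz1, hz2, hz3⟩ := hz
  have hzT : z ∉ T := fun h => hzS (Or.inr h)
  have hz2' : ∀ s t : ℝ, s • (p - z) + t • (m - z) = 0 → s = 0 ∧ t = 0 := by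
    intro s t h
    obtain ⟨h1, h2⟩ := LinearIndependent.pair_iff.1 hz2 t (-s - t) (by rw [← h]; module)
    exact ⟨by linarith, h1⟩
  have hne : ∀ y ∈ T, z ≠ y := by rintro y hy rfl; exact hzT hy
  have hT' : (T ∪ {z}).Finite := hT.union (Set.finite_singleton z)
  -- The force is relayed from `pq` to `md` along `pz` and `zm`. The auxiliary forces cancel in the
  -- sum of the three couplings, and as `p - z` and `m - z` are independent, equilibrium at `z`
  -- forces equal multiples of the three.
  have h1 : IsSupportable U (T ∪ {z}) (Submodule.span ℝ
      {c • springForce p q + (1 : ℝ) • springForce p z}) :=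
    isSupportable_of_common_endpoint hU hT' hpU (Or.inl hp) (Or.inl hq) (Or.inr rfl) hz1 hc
      one_ne_zero
  have h2 : IsSupportable U (T ∪ {z}) (Submodule.span ℝ
      {(-1 : ℝ) • springForce z p + (1 : ℝ) • springForce z m}) :=
    isSupportable_of_common_endpoint hU hT' hzU (Or.inr rfl) (Or.inl hp) (Or.inl hm)
      (LinearIndependent.pair_iff.2 hz2') (by norm_num) one_ne_zero
  have h3 : IsSupportable U (T ∪ {z}) (Submodule.span ℝ
      {c' • springForce m d + (-1 : ℝ) • springForce m z}) :=
    isSupportable_of_common_endpoint hU hT' hmU (Or.inl hm) (Or.inl hdT) (Or.inr rfl) hz3 hc'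
      (by norm_num)
  refine ⟨{z}, _, ?_, Set.finite_singleton z, (h1.sup h2 hT').sup h3 hT', ?_⟩
  · rintro _ rfl
    exact ⟨hzU, fun h => hzS (Or.inl h)⟩
  · apply le_antisymm
    · rintro v ⟨hv, hvT⟩
      obtain ⟨v₁₂, hv₁₂, v₃, hv₃, rfl⟩ := Submodule.mem_sup.1 hv
      obtain ⟨a₁, a₂, rfl⟩ := mem_span_sup_span_iff.1 hv₁₂
      obtain ⟨a₃, rfl⟩ := Submodule.mem_span_singleton.1 hv₃
      have e := hvT z hzT
      simp only [Pi.add_apply, Pi.smul_apply, springForce_apply_of_ne (hne p hp) (hne q hq),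
        springForce_apply_right (hne p hp).symm, springForce_apply_left (hne p hp),
        springForce_apply_left (hne m hm), springForce_apply_of_ne (hne m hm) (hne d hdT),
        springForce_apply_right (hne m hm).symm] at e
      obtain ⟨e1, e2⟩ := hz2' (a₂ - a₁) (a₃ - a₂) (by rw [← e]; module)
      have e3 : a₂ = a₁ := by linarith
      have e4 : a₃ = a₁ := by linarith
      rw [Submodule.mem_span_singleton]
      refine ⟨a₁, ?_⟩
      rw [e3, e4, springForce_comm z p, springForce_comm z m]
      module
    · rw [Submodule.span_singleton_le_iff_mem]
      refine ⟨?_, add_mem (Submodule.smul_mem _ _ (springForce_mem_supportedIn hp hq))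
        (Submodule.smul_mem _ _ (springForce_mem_supportedIn hm hdT))⟩
      refine Submodule.mem_sup.2 ⟨_, mem_span_sup_span_iff.2 ⟨1, 1, rfl⟩, _,
        Submodule.mem_span_singleton_self _, ?_⟩
      rw [springForce_comm z p, springForce_comm z m]
      module

/-- Two collinear springs in series act as one. This lets the dummy spring be cut at a point, with a
different coupling on each half. -/
theorem springForce_eq_lineMap (c d : V) {t : ℝ} (ht : t ≠ 0) (ht' : 1 - t ≠ 0) :
    springForce c d = t⁻¹ • springForce c (AffineMap.lineMap c d t) +
      (1 - t)⁻¹ • springForce (AffineMap.lineMap c d t) d := by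
  classical
  rw [springForce_eq_of_sub (p := c) (q := d) rfl,
    springForce_eq_of_sub (p := c) (q := AffineMap.lineMap c d t) (w := t • (c - d))
      (by rw [AffineMap.lineMap_apply_module]; module),
    springForce_eq_of_sub (p := AffineMap.lineMap c d t) (q := d) (w := (1 - t) • (c - d))
      (by rw [AffineMap.lineMap_apply_module]; module)]
  simp only [Pi.single_smul]
  match_scalars <;> field_simp
  ring

/-- If the force field `g`, coupled with an arbitrary spring, can be supported, then this
remains true after adding the force field of a spring to `g`. -/
theorem isSupportable_add_spring (hd : 2 ≤ Module.finrank ℝ V) (hU : IsOpen U)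
    (hUc : Convex ℝ U) (hT : T.Finite) {g : V → V} (hgT : g ∈ supportedIn T)
    (hg : ∀ c d : V, c ∈ U → d ∈ U → c ≠ d → ∀ k : ℝ, k ≠ 0 →
      IsSupportable U (T ∪ {c, d}) (Submodule.span ℝ {g + k • springForce c d}))
    {p q : V} (hpU : p ∈ U) (hp : p ∈ T) (hq : q ∈ T) (r : ℝ)
    {c d : V} (hc : c ∈ U) (hdU : d ∈ U) (hcd : c ≠ d) {k : ℝ} (hk : k ≠ 0) :
    IsSupportable U (T ∪ {c, d})
      (Submodule.span ℝ {g + r • springForce p q + k • springForce c d}) := by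
  by_cases hr : r = 0
  · simpa [hr] using hg c d hc hdU hcd k hk
  by_cases hpq : p = q
  · have : springForce p q = 0 := by simp [springForce, hpq]
    simpa [this] using hg c d hc hdU hcd k hk
  have hT₁ : (T ∪ {c, d}).Finite := hT.union (by simp)
  refine IsSupportable.of_elimination hT₁ fun S hS => ?_
  have hinj : Function.Injective (AffineMap.lineMap c d : ℝ → V) :=
    AffineMap.lineMap_injective ℝ hcd
  -- The dummy spring `cd` is cut at `m`: the half `cm` is coupled with `g`, the half `md` with the
  -- new spring `pq`. Equilibrium at `m` makes both couplings act with the same multiple.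
  obtain ⟨t, ⟨ht0, ht1⟩, ht⟩ := (Set.Ioo_infinite (zero_lt_one' ℝ)).exists_notMem_finite
    ((hS.union hT₁).preimage (hinj.injOn (s := _)))
  set m : V := AffineMap.lineMap c d t with hm
  have ht2 : 1 - t ≠ 0 := by linarith
  have hmU : m ∈ U := hUc.segment_subset hc hdU
    (hm ▸ lineMap_mem_segment _ _ _ ⟨ht0.le, ht1.le⟩)
  have hmS : m ∉ S ∪ (T ∪ {c, d}) := ht
  have hmc : m ≠ c := fun h => hmS (by simp [h])
  have hmd : m ≠ d := fun h => hmS (by simp [h])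
  have hpm : p ≠ m := by rintro rfl; exact hmS (by simp [hp])
  have hqm : q ≠ m := by rintro rfl; exact hmS (by simp [hq])
  have hmT : m ∉ T := fun h => hmS (by simp [h])
  have hT₂ : (T ∪ {c, d} ∪ {m}).Finite := hT₁.union (Set.finite_singleton m)
  have h1 : IsSupportable U (T ∪ {c, d} ∪ {m})
      (Submodule.span ℝ {g + (k * t⁻¹) • springForce c m}) :=
    (hg c m hc hmU hmc.symm _ (mul_ne_zero hk (inv_ne_zero ht0.ne'))).mono hT₂ (by
      intro x hx
      simp only [Set.mem_union, Set.mem_insert_iff, Set.mem_singleton_iff] at hx ⊢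
      tauto)
  have h2 : IsSupportable U (T ∪ {c, d} ∪ {m}) (Submodule.span ℝ
      {r • springForce p q + (k * (1 - t)⁻¹) • springForce m d}) :=
    isSupportable_pair hd hU hT₂ hpU hmU (by simp [hp]) (by simp [hq]) (by simp) (by simp) hpq hmd
      hpm hr (mul_ne_zero hk (inv_ne_zero ht2))
  have hg' : g + r • springForce p q + k • springForce c d =
      (g + (k * t⁻¹) • springForce c m) +
        (r • springForce p q + (k * (1 - t)⁻¹) • springForce m d) := by
    rw [springForce_eq_lineMap c d ht0.ne' ht2, ← hm]
    module
  refine ⟨{m}, _, ?_, Set.finite_singleton m, h1.sup h2 hT₂, ?_⟩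
  · rintro _ rfl
    exact ⟨hmU, fun h => hmS (Or.inl h)⟩
  · apply le_antisymm
    · rintro v ⟨hv, hvT⟩
      obtain ⟨a, b, rfl⟩ := mem_span_sup_span_iff.1 hv
      have e := hvT m fun h => hmS (Or.inr h)
      simp only [Pi.add_apply, Pi.smul_apply, hgT m hmT, springForce_apply_of_ne hpm.symm hqm.symm,
        springForce_apply_right hmc.symm, springForce_apply_left hmd] at e
      have e1 : (a - b) • (k • (d - c)) = 0 := by
        rw [← e, hm, AffineMap.lineMap_apply_module]
        match_scalars <;> field_simp <;> ring
      have e2 : a = b := by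
        have := (smul_eq_zero.1 e1).resolve_right (smul_ne_zero hk (sub_ne_zero.2 hcd.symm))
        linarith
      rw [Submodule.mem_span_singleton]
      exact ⟨a, by rw [hg', e2, smul_add]⟩
    · rw [Submodule.span_singleton_le_iff_mem]
      refine ⟨?_, ?_⟩
      · rw [hg']
        exact mem_span_sup_span_iff.2 ⟨1, 1, by simp⟩
      · refine add_mem (add_mem (supportedIn_mono Set.subset_union_left hgT)
          (Submodule.smul_mem _ _ (springForce_mem_supportedIn (Or.inl hp) (Or.inl hq))))
          (Submodule.smul_mem _ _ (springForce_mem_supportedIn ?_ ?_)) <;> simp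

/-- The dummy spring stays universally quantified, because adding one spring to `g` uses the
coupling with half of the dummy. The induction starts at the zero field, where the dummy spring
alone is enough. -/
theorem isSupportable_add_spring_of_mem_springSpan (hd : 2 ≤ Module.finrank ℝ V) (hU : IsOpen U)
    (hUc : Convex ℝ U) (hT : T.Finite) (hTU : T ⊆ U) {g : V → V}
    (hg : g ∈ springSpan (T ×ˢ T)) :
    ∀ c d : V, c ∈ U → d ∈ U → c ≠ d → ∀ k : ℝ, k ≠ 0 →
      IsSupportable U (T ∪ {c, d}) (Submodule.span ℝ {g + k • springForce c d}) := by
  have hle : springSpan (T ×ˢ T) ≤ supportedIn T := springSpan_le_supportedIn fun e he => he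
  -- the claim is stronger, so that the induction can add one spring at a time
  have key : ∀ g₀ ∈ springSpan (T ×ˢ T),
      (∀ c d : V, c ∈ U → d ∈ U → c ≠ d → ∀ k : ℝ, k ≠ 0 →
        IsSupportable U (T ∪ {c, d}) (Submodule.span ℝ {g₀ + k • springForce c d})) →
      ∀ c d : V, c ∈ U → d ∈ U → c ≠ d → ∀ k : ℝ, k ≠ 0 →
        IsSupportable U (T ∪ {c, d}) (Submodule.span ℝ {g₀ + g + k • springForce c d}) := by
    refine Submodule.closure_induction (p := fun g _ => ∀ g₀ ∈ springSpan (T ×ˢ T),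
      (∀ c d : V, c ∈ U → d ∈ U → c ≠ d → ∀ k : ℝ, k ≠ 0 →
        IsSupportable U (T ∪ {c, d}) (Submodule.span ℝ {g₀ + k • springForce c d})) →
      ∀ c d : V, c ∈ U → d ∈ U → c ≠ d → ∀ k : ℝ, k ≠ 0 →
        IsSupportable U (T ∪ {c, d}) (Submodule.span ℝ {g₀ + g + k • springForce c d}))
      ?_ ?_ ?_ hg
    · intro g₀ _ h
      simpa using h
    · intro g₁ g₂ hg₁ _ h₁ h₂ g₀ hg₀ h
      rw [← add_assoc]
      exact h₂ _ (add_mem hg₀ hg₁) (h₁ _ hg₀ h)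
    · rintro r _ ⟨e, he, rfl⟩ g₀ hg₀ h c d hc hdU hcd k hk
      exact isSupportable_add_spring hd hU hUc hT (hle hg₀) h (hTU he.1) he.1 he.2 r hc hdU hcd hk
  have h0 := key 0 (zero_mem _) fun c d hc hdU hcd k hk => by
    rw [zero_add]
    exact isSupportable_spring hcd (by simp) (by simp) hk
  simpa using h0

/-- A force field that is a combination of those of springs can be supported. -/
theorem isSupportable_of_mem_springSpan (hd : 2 ≤ Module.finrank ℝ V) (hU : IsOpen U)
    (hUc : Convex ℝ U) (hT : T.Finite) (hTU : T ⊆ U) {g : V → V}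
    (hg : g ∈ springSpan (T ×ˢ T)) : IsSupportable U T (Submodule.span ℝ {g}) := by
  have hgT : g ∈ supportedIn T := springSpan_le_supportedIn (fun e he => he) hg
  rcases T.eq_empty_or_nonempty with rfl | ⟨x, hx⟩
  · have : g = 0 := by simpa [springSpan] using hg
    have h := isSupportable_springSpan (U := U) (T := (∅ : Set V)) (E := ∅) Set.finite_empty
      (by simp)
    simpa [this, springSpan] using h
  refine IsSupportable.of_elimination hT fun S hS => ?_
  have hUne : U.Nonempty := ⟨x, hTU hx⟩
  obtain ⟨c, ⟨hcU, hcS⟩, -⟩ := exists_mem_forall_linearIndependent hd hU hUne (hS.union hT)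
    (L := ∅) Set.finite_empty (by simp)
  obtain ⟨d, ⟨hdU, hdS⟩, -⟩ := exists_mem_forall_linearIndependent hd hU hUne
    ((hS.union hT).union (Set.finite_singleton c)) (L := ∅) Set.finite_empty (by simp)
  simp only [Set.mem_union, Set.mem_singleton_iff, not_or] at hcS hdS
  have hcd : c ≠ d := fun h => hdS.2 h.symm
  have h1 := isSupportable_add_spring_of_mem_springSpan hd hU hUc hT hTU hg c d hcU hdU hcd 1
    one_ne_zero
  -- A genuine spring `cd` takes up the dummy force: equilibrium at `c` gives it the opposite
  -- multiple, and only `g` is left.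
  have h2 : IsSupportable U (T ∪ {c, d}) (Submodule.span ℝ {(1 : ℝ) • springForce c d}) :=
    isSupportable_spring hcd (by simp) (by simp) one_ne_zero
  refine ⟨{c, d}, _, ?_, by simp, h1.sup h2 (hT.union (by simp)), ?_⟩
  · rintro z (rfl | rfl)
    · exact ⟨hcU, hcS.1⟩
    · exact ⟨hdU, hdS.1.1⟩
  · apply le_antisymm
    · rintro v ⟨hv, hvT⟩
      obtain ⟨a, b, rfl⟩ := mem_span_sup_span_iff.1 hv
      have e := hvT c hcS.2
      simp only [Pi.add_apply, Pi.smul_apply, hgT c hcS.2, springForce_apply_left hcd] at e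
      have e1 : (a + b) • (c - d) = 0 := by rw [← e]; module
      have e2 : b = -a := by
        have := (smul_eq_zero.1 e1).resolve_right (sub_ne_zero.2 hcd)
        linarith
      rw [Submodule.mem_span_singleton]
      exact ⟨a, by rw [e2]; module⟩
    · rw [Submodule.span_singleton_le_iff_mem]
      exact ⟨mem_span_sup_span_iff.2 ⟨1, -1, by module⟩, hgT⟩

end Generic

/-! ### Balanced forces as combinations of spring forces -/

section Balanced

variable {V : Type*} [NormedAddCommGroup V] [InnerProductSpace ℝ V]

open scoped RealInnerProductSpace

/-- The displacements `u` of the nodes `p` and `q` change the length of a spring that joins them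
by this number, up to first order and up to the distance of the nodes as a factor. -/
def elongation (p q : V) : (V → V) →ₗ[ℝ] ℝ :=
  (innerₗ V (p - q)).comp
    ((LinearMap.proj p : (V → V) →ₗ[ℝ] V) - (LinearMap.proj q : (V → V) →ₗ[ℝ] V))

theorem elongation_apply (p q : V) (u : V → V) : elongation p q u = ⟪p - q, u p - u q⟫ := rfl

theorem elongation_comm (p q : V) : elongation p q = elongation q p := by
  ext u
  rw [elongation_apply, elongation_apply, ← inner_neg_neg]
  simp

open Classical in
theorem elongation_single (p q x v : V) :
    elongation p q (Pi.single x v) = ⟪springForce p q x, v⟫ := by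
  rw [elongation_apply, springForce_eq_of_sub rfl]
  rw [Pi.sub_apply, inner_sub_right]
  conv_rhs => rw [inner_sub_left]
  congr 1
  · by_cases h : p = x
    · subst h; simp
    · simp [h, Ne.symm h]
  · by_cases h : q = x
    · subst h; simp
    · simp [h, Ne.symm h]

theorem sum_inner_springForce {N : Finset V} {p q : V} (hp : p ∈ N) (hq : q ∈ N) (u : V → V) :
    ∑ x ∈ N, ⟪springForce p q x, u x⟫ = elongation p q u := by
  classical
  rw [springForce_eq_of_sub rfl, elongation_apply]
  simp only [Pi.sub_apply, inner_sub_left, inner_sub_right, Finset.sum_sub_distrib]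
  congr 1
  · rw [Finset.sum_eq_single_of_mem p hp fun x _ hx => by simp [hx]]
    simp [inner_sub_left]
  · rw [Finset.sum_eq_single_of_mem q hq fun x _ hx => by simp [hx]]
    simp [inner_sub_left]

theorem sum_single_of_mem_supportedIn {T : Finset V} {g : V → V}
    (hg : g ∈ supportedIn (T : Set V)) :
    g = by classical exact ∑ x ∈ T, Pi.single x (g x) := by
  classical
  ext z
  by_cases hz : z ∈ T
  · simp [Finset.sum_apply, Pi.single_apply, hz]
  · simp [Finset.sum_apply, Pi.single_apply, hz, hg z (by simpa using hz)]

variable [FiniteDimensional ℝ V]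

/-- Riesz representation at each point. It turns a functional on force fields into a displacement
field; the functional kills a spring force exactly when the displacements do not stretch that
spring. -/
theorem exists_inner_eq_dual (f : (V → V) →ₗ[ℝ] ℝ) :
    ∃ φ : V → V, (∀ p q : V, f (springForce p q) = elongation p q φ) ∧
      ∀ (T : Finset V) (g : V → V), g ∈ supportedIn (T : Set V) → f g = ∑ x ∈ T, ⟪φ x, g x⟫ := by
  classical
  have h : ∀ x : V, ∃ y : V, ∀ v : V, f (Pi.single x v) = ⟪y, v⟫ := fun x => by
    refine ⟨(InnerProductSpace.toDual ℝ V).symm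
      (LinearMap.toContinuousLinearMap (f.comp (LinearMap.single ℝ (fun _ => V) x))), fun v => ?_⟩
    rw [InnerProductSpace.toDual_symm_apply]
    rfl
  choose φ hφ using h
  refine ⟨φ, fun p q => ?_, fun T g hg => ?_⟩
  · rw [springForce_eq_of_sub rfl, map_sub, hφ, hφ, ← inner_sub_left, real_inner_comm]
    rfl
  · conv_lhs => rw [sum_single_of_mem_supportedIn hg, map_sum]
    exact Finset.sum_congr rfl fun x _ => hφ _ _

/-- A balanced system of forces is a combination of those of springs joining the points where the
forces are applied and further points nearby. -/
theorem exists_mem_springSpan_of_balanced {U : Set V} (hU : IsOpen U) {T : Finset V}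
    (hTU : (T : Set V) ⊆ U) {g : V → V} (hg : g ∈ supportedIn (T : Set V))
    (hsum : ∑ x ∈ T, g x = 0)
    (hskew : ∀ A : V →ₗ[ℝ] V, (∀ x, ⟪A x, x⟫ = 0) → ∑ x ∈ T, ⟪A x, g x⟫ = 0)
    {S : Set V} (hS : S.Finite) :
    ∃ Y : Set V, Y ⊆ U \ S ∧ Y.Finite ∧ g ∈ springSpan ((↑T ∪ Y) ×ˢ (↑T ∪ Y)) := by
  rcases T.eq_empty_or_nonempty with rfl | ⟨x₀, hx₀⟩
  · have : g = 0 := funext fun z => hg z (by simp)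
    exact ⟨∅, by simp, by simp, this ▸ zero_mem _⟩
  have hx₀U : x₀ ∈ U := hTU hx₀
  let b := stdOrthonormalBasis ℝ V
  have hlim : ∀ᶠ t : ℝ in nhdsWithin 0 {0}ᶜ, ∀ i, x₀ + t • b i ∈ U \ S := by
    refine Filter.eventually_all.2 fun i => ?_
    refine eventually_mem_diff_of_tendsto (x₀ := x₀) ?_ ?_ hU hx₀U hS
    · have : Filter.Tendsto (fun t : ℝ => x₀ + t • b i) (nhds 0) (nhds (x₀ + (0 : ℝ) • b i)) :=
        Continuous.tendsto (by fun_prop) 0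
      simpa using this.mono_left nhdsWithin_le_nhds
    · filter_upwards [self_mem_nhdsWithin] with t ht
      simpa [b.toBasis.ne_zero i, b.orthonormal.ne_zero i] using ht
  obtain ⟨t, ht0, ht⟩ := (eventually_mem_nhdsWithin.and hlim).exists
  have ht0 : t ≠ 0 := ht0
  -- Together with `x₀`, these points are the vertices of a small simplex, which makes the complete
  -- graph on the nodes infinitesimally rigid.
  set Y : Set V := Set.range fun i => x₀ + t • b i with hY
  refine ⟨Y, by rintro _ ⟨i, rfl⟩; exact ht i, Set.finite_range _, ?_⟩
  -- Otherwise some displacement field `φ` stretches no spring but does work against `g`. Rigidity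
  -- makes `φ` an infinitesimal rigid motion on `T`, and a balanced `g` does no work along such a
  -- motion.
  by_contra hcon
  obtain ⟨f, hfg, hf⟩ := Submodule.exists_le_ker_of_notMem hcon
  obtain ⟨φ, hφf, hφg⟩ := exists_inner_eq_dual f
  have hspring : ∀ p ∈ (T : Set V) ∪ Y, ∀ q ∈ (T : Set V) ∪ Y, ⟪φ p - φ q, p - q⟫ = 0 := by
    intro p hp q hq
    rw [real_inner_comm, ← elongation_apply, ← hφf p q]
    exact hf (Submodule.subset_span ⟨(p, q), ⟨hp, hq⟩, rfl⟩)
  have hyY : ∀ i, x₀ + t • b i ∈ (T : Set V) ∪ Y := fun i => Or.inr ⟨i, rfl⟩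
  have hxT : ∀ x ∈ T, x ∈ (T : Set V) ∪ Y := fun x hx => Or.inl hx
  -- The linear part of the motion, read off from the edges of the simplex at `x₀`. Its edges being
  -- unstretched makes `A` skew.
  let A : V →ₗ[ℝ] V := b.toBasis.constr ℝ fun i => t⁻¹ • (φ (x₀ + t • b i) - φ x₀)
  have hA : ∀ i, A (b i) = t⁻¹ • (φ (x₀ + t • b i) - φ x₀) := fun i => by
    have := b.toBasis.constr_basis ℝ (fun i => t⁻¹ • (φ (x₀ + t • b i) - φ x₀)) i
    rwa [b.coe_toBasis] at this
  have hφy : ∀ i, φ (x₀ + t • b i) = φ x₀ + t • A (b i) := fun i => by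
    rw [hA, smul_inv_smul₀ ht0]; abel
  have hbi : ∀ i, ⟪A (b i), b i⟫ = 0 := fun i => by
    have := hspring _ (hyY i) _ (hxT _ hx₀)
    rw [hφy, add_sub_cancel_left, add_sub_cancel_left, real_inner_smul_left,
      real_inner_smul_right] at this
    simpa [ht0] using this
  have hbij : ∀ i j, ⟪A (b i), b j⟫ + ⟪A (b j), b i⟫ = 0 := fun i j => by
    have := hspring _ (hyY i) _ (hyY j)
    rw [hφy, hφy, add_sub_add_left_eq_sub, add_sub_add_left_eq_sub, ← smul_sub, ← smul_sub,
      real_inner_smul_left, real_inner_smul_right, inner_sub_left, inner_sub_right,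
      inner_sub_right, hbi, hbi] at this
    have h2 : 0 - ⟪A (b i), b j⟫ - (⟪A (b j), b i⟫ - 0) = 0 := by simpa [ht0] using this
    linarith
  have hbx : ∀ j x, ⟪A x, b j⟫ + ⟪A (b j), x⟫ = 0 := fun j x => by
    have h1 : (innerₗ V (b j)).comp A + innerₗ V (A (b j)) = 0 := by
      refine b.toBasis.ext fun i => ?_
      have := hbij i j
      rw [real_inner_comm] at this
      simpa using this
    have := LinearMap.congr_fun h1 x
    rw [real_inner_comm]
    simpa using this
  have hxy : ∀ x y, ⟪A x, y⟫ + ⟪A y, x⟫ = 0 := fun x y => by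
    have h1 : innerₗ V (A x) + (innerₗ V x).comp A = 0 := by
      refine b.toBasis.ext fun i => ?_
      have := hbx i x
      rw [real_inner_comm x] at this
      simpa using this
    have := LinearMap.congr_fun h1 y
    rw [real_inner_comm x]
    simpa using this
  have hAx : ∀ x, ⟪A x, x⟫ = 0 := fun x => by linarith [hxy x x]
  -- The deviation of `φ x` from the rigid motion is orthogonal to the lines from `x` to all
  -- vertices of the simplex, hence to each `b i`.
  have hrigid : ∀ x ∈ T, φ x = φ x₀ + A (x - x₀) := by
    intro x hx
    rw [← sub_eq_zero]
    have h1 : ⟪φ x - (φ x₀ + A (x - x₀)), x - x₀⟫ = 0 := by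
      rw [← sub_sub, inner_sub_left, hspring _ (hxT x hx) _ (hxT _ hx₀), hAx, sub_zero]
    have h2 : ∀ i, ⟪φ x - (φ x₀ + A (x - x₀)), x - (x₀ + t • b i)⟫ = 0 := fun i => by
      have h3 : φ x - (φ x₀ + A (x - x₀)) =
          φ x - φ (x₀ + t • b i) - A (x - (x₀ + t • b i)) := by
        rw [hφy, map_sub, map_sub, map_add, map_smul]
        abel
      rw [h3, inner_sub_left, hspring _ (hxT x hx) _ (hyY i), hAx, sub_zero]
    refine InnerProductSpace.ext_inner_right_basis b.toBasis fun i => ?_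
    have h4 := h2 i
    rw [sub_add_eq_sub_sub x, inner_sub_right, h1, real_inner_smul_right, zero_sub,
      neg_eq_zero] at h4
    simpa [ht0] using h4
  refine hfg ?_
  rw [hφg T g hg]
  have : ∀ x ∈ T, ⟪φ x, g x⟫ = ⟪φ x₀ - A x₀, g x⟫ + ⟪A x, g x⟫ := fun x hx => by
    rw [hrigid x hx, map_sub, ← inner_add_left]
    congr 1
    abel
  rw [Finset.sum_congr rfl this, Finset.sum_add_distrib, ← inner_sum, hsum, inner_zero_right,
    hskew A hAx, add_zero]

/-- Each balanced system of forces can be supported. -/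
theorem isSupportable_of_balanced (hd : 2 ≤ Module.finrank ℝ V) {U : Set V} (hU : IsOpen U)
    (hUc : Convex ℝ U) {T : Finset V} (hTU : (T : Set V) ⊆ U) {g : V → V}
    (hg : g ∈ supportedIn (T : Set V)) (hsum : ∑ x ∈ T, g x = 0)
    (hskew : ∀ A : V →ₗ[ℝ] V, (∀ x, ⟪A x, x⟫ = 0) → ∑ x ∈ T, ⟪A x, g x⟫ = 0) :
    IsSupportable U (T : Set V) (Submodule.span ℝ {g}) := by
  refine IsSupportable.of_elimination T.finite_toSet fun S hS => ?_
  obtain ⟨Y, hY, hYf, hgY⟩ := exists_mem_springSpan_of_balanced hU hTU hg hsum hskew hS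
  exact ⟨Y, _, hY, hYf, isSupportable_of_mem_springSpan hd hU hUc (T.finite_toSet.union hYf)
    (Set.union_subset hTU (hY.trans Set.sdiff_subset)) hgY, span_singleton_inf_supportedIn hg⟩

end Balanced

/-! ### Existence of equilibria for semidefinite forms -/

section Stationary

/-- A symmetric bilinear form that is definite up to its kernel has stationary points on the
translates of each finite-dimensional space. -/
theorem exists_stationary {X X₀ : Type*} [AddCommGroup X] [Module ℝ X] [AddCommGroup X₀]
    [Module ℝ X₀] [FiniteDimensional ℝ X₀] (B : X →ₗ[ℝ] X →ₗ[ℝ] ℝ) (hB : ∀ x y, B x y = B y x)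
    (hB' : ∀ x, B x x = 0 → ∀ y, B x y = 0) (j : X₀ →ₗ[ℝ] X) (u : X) :
    ∃ w, ∀ z, B (u + j w) (j z) = 0 := by
  let φ : X₀ →ₗ[ℝ] Module.Dual ℝ X₀ := B.compl₁₂ j j
  -- Solvability criterion: the right-hand side must kill the kernel of `φ`. A vector `w` of that
  -- kernel has `B (j w) (j w) = 0`, so `j w` is orthogonal to everything.
  have h : -(B u).comp j ∈ (LinearMap.ker φ).dualAnnihilator := by
    rw [Submodule.mem_dualAnnihilator]
    intro w hw
    have h1 : B (j w) (j w) = 0 := LinearMap.congr_fun (LinearMap.mem_ker.1 hw) w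
    simp [hB u, hB' _ h1]
  rw [← LinearMap.range_dualMap_eq_dualAnnihilator_ker] at h
  obtain ⟨Φ, hΦ⟩ := h
  obtain ⟨w, rfl⟩ := (Module.evalEquiv ℝ X₀).surjective Φ
  refine ⟨w, fun z => ?_⟩
  have h2 : B (j z) (j w) = -B u (j z) := LinearMap.congr_fun hΦ z
  rw [map_add, LinearMap.add_apply, hB (j w), h2, add_neg_cancel]

end Stationary

/-! ### From supportable forces to networks with a response of rank one -/

section Synthesis

variable {V : Type*} [NormedAddCommGroup V] [InnerProductSpace ℝ V]

open scoped RealInnerProductSpace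

/-- The forces at the nodes in `N`, for the displacements `u`, if the nodes `p` and `q` are joined
by a spring of constant `‖p - q‖ ^ 2 * k p q`. -/
def networkForce (N : Finset V) (k : V → V → ℝ) (u : V → V) : V → V :=
  (1 / 2 : ℝ) • ∑ p ∈ N, ∑ q ∈ N, (k p q * elongation p q u) • springForce p q

/-- For each finite set `S`, there is a network of springs with terminals `T` and internal nodes
in `U \ S`, with the terminal forces `R u` for displacements `u` of the terminals. -/
def IsSynthesizable (U : Set V) (T : Finset V) (R : (V → V) → V → V) : Prop :=
  ∀ S : Set V, S.Finite → ∃ (N : Finset V) (k : V → V → ℝ), T ⊆ N ∧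
    (∀ x ∈ N, x ∉ T → x ∈ U \ S) ∧ (∀ p q, k p q = k q p) ∧ (∀ p q, 0 ≤ k p q) ∧
    (∀ p q, k p q ≠ 0 → p ∈ N ∧ q ∈ N) ∧
    ∀ u : V → V, ∃ w : V → V, (∀ x ∈ T, w x = u x) ∧ networkForce N k w = R u

theorem networkForce_congr {N : Finset V} {k : V → V → ℝ} {u v : V → V}
    (h : ∀ x ∈ N, u x = v x) : networkForce N k u = networkForce N k v := by
  rw [networkForce, networkForce]
  congr 1
  refine Finset.sum_congr rfl fun p hp => Finset.sum_congr rfl fun q hq => ?_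
  rw [elongation_apply, elongation_apply, h p hp, h q hq]

theorem networkForce_subset {N N' : Finset V} (hN : N ⊆ N') {k : V → V → ℝ}
    (hk : ∀ p q, k p q ≠ 0 → p ∈ N ∧ q ∈ N) (u : V → V) :
    networkForce N' k u = networkForce N k u := by
  rw [networkForce, networkForce]
  congr 1
  rw [← Finset.sum_subset hN]
  · refine Finset.sum_congr rfl fun p _ => ?_
    rw [← Finset.sum_subset hN]
    intro q _ hq
    rw [show k p q = 0 from not_not.1 fun h => hq (hk p q h).2]
    simp
  · intro p _ hp
    refine Finset.sum_eq_zero fun q _ => ?_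
    rw [show k p q = 0 from not_not.1 fun h => hp (hk p q h).1]
    simp

theorem networkForce_add (N : Finset V) (k k' : V → V → ℝ) (u : V → V) :
    networkForce N (k + k') u = networkForce N k u + networkForce N k' u := by
  simp only [networkForce, ← smul_add, ← Finset.sum_add_distrib, ← add_smul, ← add_mul,
    Pi.add_apply]

variable {U : Set V} {T : Finset V}

theorem isSynthesizable_zero (U : Set V) (T : Finset V) :
    IsSynthesizable U T fun _ => 0 := by
  intro S _
  refine ⟨T, 0, subset_rfl, fun x hx hx' => absurd hx hx', by simp, by simp, by simp, fun u =>
    ⟨u, fun _ _ => rfl, by simp [networkForce]⟩⟩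

/-- The two networks share only terminals, where their displacements agree, so the displacements can
be glued and the forces add. -/
theorem IsSynthesizable.add {R₁ R₂ : (V → V) → V → V} (h₁ : IsSynthesizable U T R₁)
    (h₂ : IsSynthesizable U T R₂) : IsSynthesizable U T fun u => R₁ u + R₂ u := by
  classical
  intro S hS
  obtain ⟨N₁, k₁, hT₁, hN₁, hs₁, hp₁, hk₁, hR₁⟩ := h₁ S hS
  obtain ⟨N₂, k₂, hT₂, hN₂, hs₂, hp₂, hk₂, hR₂⟩ := h₂ (S ∪ N₁) (hS.union N₁.finite_toSet)
  refine ⟨N₁ ∪ N₂, k₁ + k₂, hT₁.trans Finset.subset_union_left, ?_, fun p q => ?_, fun p q =>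
    add_nonneg (hp₁ p q) (hp₂ p q), fun p q h => ?_, fun u => ?_⟩
  · intro x hx hxT
    rcases Finset.mem_union.1 hx with hx | hx
    · exact hN₁ x hx hxT
    · exact ⟨(hN₂ x hx hxT).1, fun h => (hN₂ x hx hxT).2 (Or.inl h)⟩
  · simp only [Pi.add_apply, hs₁ p q, hs₂ p q]
  · by_cases h1 : k₁ p q = 0
    · have h2 : k₂ p q ≠ 0 := fun h2 => h (by simp [h1, h2])
      exact ⟨Finset.mem_union_right _ (hk₂ p q h2).1, Finset.mem_union_right _ (hk₂ p q h2).2⟩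
    · exact ⟨Finset.mem_union_left _ (hk₁ p q h1).1, Finset.mem_union_left _ (hk₁ p q h1).2⟩
  · obtain ⟨w₁, hw₁, hf₁⟩ := hR₁ u
    obtain ⟨w₂, hw₂, hf₂⟩ := hR₂ u
    refine ⟨fun x => if x ∈ N₁ then w₁ x else w₂ x, fun x hx => ?_, ?_⟩
    · exact (if_pos (hT₁ hx)).trans (hw₁ x hx)
    · rw [networkForce_add, networkForce_subset Finset.subset_union_left hk₁,
        networkForce_subset Finset.subset_union_right hk₂]
      beta_reduce
      rw [← hf₁, ← hf₂]
      congr 1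
      · exact networkForce_congr fun x hx => if_pos hx
      · refine networkForce_congr fun x hx => ?_
        split_ifs with hx₁
        · have hxT : x ∈ T := by
            by_contra hxT
            exact (hN₂ x hx hxT).2 (Or.inr hx₁)
          rw [hw₁ x hxT, hw₂ x hxT]
        · rfl

theorem isSynthesizable_sum {ι : Type*} (s : Finset ι) {R : ι → (V → V) → V → V}
    (h : ∀ i ∈ s, IsSynthesizable U T (R i)) : IsSynthesizable U T fun u => ∑ i ∈ s, R i u := by
  classical
  induction s using Finset.induction_on with
  | empty => simpa using isSynthesizable_zero U T
  | insert i s hi ih =>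
    simp only [Finset.sum_insert hi]
    exact (h i (by simp)).add (ih fun j hj => h j (by simp [hj]))

/-- The indicator of `E` is symmetrised because spring constants are symmetric; the factor `1 / 2`
in `networkForce` makes up for it. -/
theorem networkForce_edges [DecidableEq V] {N : Finset V} {E : Finset (V × V)}
    (hE : E ⊆ N ×ˢ N) (c : ℝ) (u : V → V) :
    networkForce N (fun p q => c * ((if (p, q) ∈ E then 1 else 0) +
      (if (q, p) ∈ E then 1 else 0))) u =
      c • ∑ e ∈ E, elongation e.1 e.2 u • springForce e.1 e.2 := by
  have key : ∑ e ∈ E, elongation e.1 e.2 u • springForce e.1 e.2 =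
      ∑ p ∈ N, ∑ q ∈ N, if (p, q) ∈ E then elongation p q u • springForce p q else 0 := by
    rw [← Finset.sum_product', ← Finset.sum_filter, Finset.filter_mem_eq_inter,
      Finset.inter_eq_right.2 hE]
  have key' : ∑ e ∈ E, elongation e.1 e.2 u • springForce e.1 e.2 =
      ∑ p ∈ N, ∑ q ∈ N, if (q, p) ∈ E then elongation p q u • springForce p q else 0 := by
    rw [key, Finset.sum_comm]
    refine Finset.sum_congr rfl fun p _ => Finset.sum_congr rfl fun q _ => ?_
    rw [elongation_comm, springForce_comm]
  have h2 : c • ∑ e ∈ E, elongation e.1 e.2 u • springForce e.1 e.2 = (1 / 2 : ℝ) •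
      (c • (∑ e ∈ E, elongation e.1 e.2 u • springForce e.1 e.2) +
        c • ∑ e ∈ E, elongation e.1 e.2 u • springForce e.1 e.2) := by module
  rw [h2]
  conv_rhs => enter [2, 1]; rw [key]
  conv_rhs => enter [2, 2]; rw [key']
  rw [networkForce]
  simp only [Finset.smul_sum, ← Finset.sum_add_distrib]
  refine Finset.sum_congr rfl fun p _ => Finset.sum_congr rfl fun q _ => ?_
  split_ifs <;> module

variable [FiniteDimensional ℝ V]

/-- The force fields of the springs are attained by displacements of the nodes. -/
theorem exists_sum_elongation_eq (E : Finset (V × V)) {g : V → V}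
    (hg : g ∈ springSpan (E : Set (V × V))) :
    ∃ u, ∑ e ∈ E, elongation e.1 e.2 u • springForce e.1 e.2 = g := by
  let L : (V → V) →ₗ[ℝ] V → V :=
    ∑ e ∈ E, (elongation e.1 e.2).smulRight (springForce e.1 e.2)
  have hL : ∀ u, L u = ∑ e ∈ E, elongation e.1 e.2 u • springForce e.1 e.2 := fun u => by
    simp [L, LinearMap.sum_apply]
  suffices g ∈ LinearMap.range L by
    obtain ⟨u, hu⟩ := this
    exact ⟨u, by rw [← hL, hu]⟩
  by_contra hcon
  obtain ⟨f, hfg, hf⟩ := Submodule.exists_le_ker_of_notMem hcon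
  obtain ⟨φ, hφ, -⟩ := exists_inner_eq_dual f
  -- Testing the functional on the forces caused by its own displacement field gives a sum of
  -- squares.
  have h1 : ∑ e ∈ E, elongation e.1 e.2 φ * elongation e.1 e.2 φ = 0 := by
    have : f (L φ) = 0 := hf ⟨φ, rfl⟩
    rw [hL, map_sum] at this
    simpa [hφ] using this
  rw [Finset.sum_eq_zero_iff_of_nonneg fun e _ => mul_self_nonneg _] at h1
  refine hfg ?_
  have h2 : springSpan (E : Set (V × V)) ≤ LinearMap.ker f := by
    refine Submodule.span_le.2 ?_
    rintro _ ⟨e, he, rfl⟩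
    rw [SetLike.mem_coe, LinearMap.mem_ker, hφ]
    exact mul_self_eq_zero.1 (h1 e he)
  exact h2 hg

/-- For unit constants the equilibrium forces are some `a g`. A state `u'` with forces exactly `g`
determines `a` by reciprocity of the energy form `B`: `a * B u' u' = g · u`. Spring constants `B u'
u'` then give the forces `(g · u) g`. -/
theorem IsSupportable.isSynthesizable {g : V → V}
    (h : IsSupportable U (T : Set V) (Submodule.span ℝ {g})) :
    IsSynthesizable U T fun u => (∑ x ∈ T, ⟪g x, u x⟫) • g := by
  classical
  by_cases hg0 : g = 0
  · simpa [hg0] using isSynthesizable_zero U T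
  intro S hS
  obtain ⟨E', hE'f, hE', hH⟩ := h S hS
  lift E' to Finset (V × V) using hE'f
  set E : Finset (V × V) := E'
  have hgE : g ∈ springSpan (E : Set (V × V)) ⊓ supportedIn (S ∪ T) :=
    hH ▸ Submodule.mem_span_singleton_self g
  have hgT : g ∈ supportedIn (T : Set V) := h.le_supportedIn (Submodule.mem_span_singleton_self g)
  obtain ⟨u', hu'⟩ := exists_sum_elongation_eq E hgE.1
  set N : Finset V := T ∪ (E.image Prod.fst ∪ E.image Prod.snd) with hN
  have hEN : ∀ e ∈ E, e.1 ∈ N ∧ e.2 ∈ N := fun e he => by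
    constructor
    · exact Finset.mem_union_right _ (Finset.mem_union_left _ (Finset.mem_image_of_mem _ he))
    · exact Finset.mem_union_right _ (Finset.mem_union_right _ (Finset.mem_image_of_mem _ he))
  let B : (V → V) →ₗ[ℝ] (V → V) →ₗ[ℝ] ℝ :=
    ∑ e ∈ E, (elongation e.1 e.2).smulRight (elongation e.1 e.2)
  have hB : ∀ u v, B u v = ∑ e ∈ E, elongation e.1 e.2 u * elongation e.1 e.2 v := fun u v => by
    simp [B, LinearMap.sum_apply]
  have hBsymm : ∀ u v, B u v = B v u := fun u v => by
    simp only [hB, mul_comm]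
  have hB0 : ∀ u, B u u = 0 → ∀ e ∈ E, elongation e.1 e.2 u = 0 := fun u hu e he => by
    rw [hB, Finset.sum_eq_zero_iff_of_nonneg fun e _ => mul_self_nonneg _] at hu
    exact mul_self_eq_zero.1 (hu e he)
  have hBsum : ∀ u v, ∑ x ∈ N, ⟪(∑ e ∈ E, elongation e.1 e.2 u • springForce e.1 e.2) x, v x⟫ =
      B u v := fun u v => by
    simp only [Finset.sum_apply, Pi.smul_apply, sum_inner, real_inner_smul_left]
    rw [Finset.sum_comm, hB]
    refine Finset.sum_congr rfl fun e he => ?_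
    rw [← Finset.mul_sum, sum_inner_springForce (hEN e he).1 (hEN e he).2]
  have hBg : ∀ v, B u' v = ∑ x ∈ T, ⟪g x, v x⟫ := fun v => by
    rw [← hBsum, hu']
    refine (Finset.sum_subset Finset.subset_union_left ?_).symm
    intro x _ hx
    rw [hgT x (by simpa using hx), inner_zero_left]
  have hc : 0 < B u' u' := by
    refine lt_of_le_of_ne ?_ fun h0 => hg0 ?_
    · rw [hB]
      exact Finset.sum_nonneg fun e _ => mul_self_nonneg _
    · rw [← hu']
      exact Finset.sum_eq_zero fun e he => by rw [hB0 u' h0.symm e he, zero_smul]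
  refine ⟨N, fun p q => B u' u' * ((if (p, q) ∈ E then 1 else 0) +
    (if (q, p) ∈ E then 1 else 0)), Finset.subset_union_left, ?_, ?_, ?_, ?_, fun u => ?_⟩
  · intro x hx hxT
    have hxE : x ∈ E.image Prod.fst ∪ E.image Prod.snd := (Finset.mem_union.1 hx).resolve_left hxT
    rw [Finset.mem_union, Finset.mem_image, Finset.mem_image] at hxE
    rcases hxE with ⟨e, he, rfl⟩ | ⟨e, he, rfl⟩
    · exact (hE' e he).2.1.resolve_left hxT
    · exact (hE' e he).2.2.resolve_left hxT
  · intro p q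
    beta_reduce
    rw [add_comm]
  · intro p q
    refine mul_nonneg hc.le (add_nonneg ?_ ?_) <;> split_ifs <;> norm_num
  · intro p q hpq
    by_cases h1 : (p, q) ∈ E
    · exact hEN _ h1
    · by_cases h2 : (q, p) ∈ E
      · exact (hEN _ h2).symm
      · simp [h1, h2] at hpq
  · let j : ({x // x ∈ N ∧ x ∉ T} → V) →ₗ[ℝ] V → V :=
      { toFun := fun w x => if hx : x ∈ N ∧ x ∉ T then w ⟨x, hx⟩ else 0
        map_add' := fun w w' => by ext x; by_cases hx : x ∈ N ∧ x ∉ T <;> simp [hx]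
        map_smul' := fun c w => by ext x; by_cases hx : x ∈ N ∧ x ∉ T <;> simp [hx] }
    have : Finite {x // x ∈ N ∧ x ∉ T} := Finite.of_injective
      (fun x => (⟨x.1, x.2.1⟩ : {x // x ∈ N})) fun x y hxy => by
        simpa [Subtype.ext_iff] using hxy
    have := Fintype.ofFinite {x // x ∈ N ∧ x ∉ T}
    obtain ⟨w, hw⟩ := exists_stationary B hBsymm (fun v hv v' => by
      rw [hB]
      exact Finset.sum_eq_zero fun e he => by rw [hB0 v hv e he, zero_mul]) j u
    have hjT : ∀ x ∈ T, j w x = 0 := fun x hx => dif_neg fun h => h.2 hx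
    refine ⟨u + j w, fun x hx => by simp [hjT x hx], ?_⟩
    rw [networkForce_edges (fun e he => Finset.mem_product.2 (hEN e he))]
    set F : V → V := ∑ e ∈ E, elongation e.1 e.2 (u + j w) • springForce e.1 e.2 with hF
    have hFspan : F ∈ springSpan (E : Set (V × V)) := sum_mem fun e he =>
      Submodule.smul_mem _ _ (Submodule.subset_span ⟨e, he, rfl⟩)
    have hFT : F ∈ supportedIn (T : Set V) := by
      intro x hx
      by_cases hxN : x ∈ N
      · have hj : ∀ v, j (Pi.single ⟨x, hxN, hx⟩ v) = Pi.single x v := fun v => by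
          ext y
          by_cases hy : y = x
          · subst hy
            have : y ∉ T := hx
            simp [j, hxN, this]
          · by_cases hy' : y ∈ N ∧ y ∉ T <;> simp [j, hy', hy]
        refine ext_inner_right ℝ fun v => ?_
        have := hw (Pi.single ⟨x, hxN, hx⟩ v)
        rw [hj, hB] at this
        simp only [elongation_single] at this
        rw [inner_zero_left, ← this, hF, Finset.sum_apply, sum_inner]
        exact Finset.sum_congr rfl fun e _ => by rw [Pi.smul_apply, real_inner_smul_left]
      · exact springSpan_le_supportedIn (S := (N : Set V)) (fun e he => hEN e he) hFspan x hxN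
    have hFg : F ∈ Submodule.span ℝ {g} :=
      hH ▸ ⟨hFspan, supportedIn_mono Set.subset_union_right hFT⟩
    obtain ⟨a, ha⟩ := Submodule.mem_span_singleton.1 hFg
    -- Both sides equal `B (u + j w) u'`: one as the work of `F = a g` along `u'`, the other as the
    -- work of `g` along `u + j w`.
    have h1 : a * B u' u' = ∑ x ∈ T, ⟪g x, u x⟫ := by
      have h2 : B (u + j w) u' = a * B u' u' := by
        rw [← hBsum, ← hF, ← ha, hBg, Finset.mul_sum]
        rw [← Finset.sum_subset (Finset.subset_union_left : T ⊆ N)]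
        · exact Finset.sum_congr rfl fun x _ => by rw [Pi.smul_apply, real_inner_smul_left]
        · intro x _ hx
          rw [Pi.smul_apply, hgT x (by simpa using hx), smul_zero, inner_zero_left]
      rw [← h2, hBsymm, hBg]
      exact Finset.sum_congr rfl fun x hx => by rw [Pi.add_apply, hjT x hx, add_zero]
    rw [← ha, smul_smul, mul_comm, h1]

end Synthesis

/-! ### The response of a massless network -/

namespace DampedNetwork

variable {d n m : ℕ} (net : DampedNetwork d n m)

theorem massMatrix_eq_zero (h : net.IsMassless) : net.massMatrix = 0 := by
  ext p q
  simp [massMatrix, Matrix.diagonal_apply, h p.1]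

theorem dynMatrix_eq {α β : ℝ} (h : net.IsMassless) (h' : net.IsRayleigh α β) (s : ℂ) :
    net.dynMatrix s = (1 + (α : ℂ) * s) • net.stiffnessMatrix.map Complex.ofReal := by
  have hC : net.dampingMatrix = α • net.stiffnessMatrix := by
    rw [h', net.massMatrix_eq_zero h, smul_zero, add_zero]
  ext p q
  simp only [dynMatrix, hC, net.massMatrix_eq_zero h, Matrix.add_apply, Matrix.smul_apply,
    Matrix.map_apply, Matrix.zero_apply, smul_eq_mul, Complex.ofReal_mul, Complex.ofReal_zero]
  ring

theorem stiffnessMatrix_posSemidef : net.stiffnessMatrix.PosSemidef := by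
  refine Matrix.PosSemidef.smul (Matrix.posSemidef_sum _ fun i _ => Matrix.posSemidef_sum _
    fun j _ => Matrix.PosSemidef.smul ?_ (net.stiff_nonneg i j)) (by norm_num)
  exact (Matrix.posSemidef_vecMulVec_self_star (R := ℝ) _).kronecker
    (Matrix.posSemidef_vecMulVec_self_star (R := ℝ) _)

theorem stiffnessMatrix_mulVec (u : (Fin n ⊕ Fin m) × Fin d → ℝ) (x : Fin n ⊕ Fin m) (a : Fin d) :
    (net.stiffnessMatrix.mulVec u) (x, a) = 1 / 2 * ∑ i, ∑ j,
      (net.stiff i j * ∑ b, net.unitVec i j b * (u (i, b) - u (j, b))) *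
        (((if x = i then 1 else 0) - (if x = j then 1 else 0)) * net.unitVec i j a) := by
  have h : ∀ i j, ((net.springMat i j).mulVec u) (x, a) =
      (∑ b, net.unitVec i j b * (u (i, b) - u (j, b))) *
        (((if x = i then 1 else 0) - (if x = j then 1 else 0)) * net.unitVec i j a) := by
    intro i j
    simp only [springMat, Matrix.mulVec, dotProduct, Fintype.sum_prod_type,
      Matrix.kroneckerMap_apply, Matrix.vecMulVec_apply, Pi.sub_apply, Pi.single_apply]
    rw [Finset.sum_comm, Finset.sum_mul]
    refine Finset.sum_congr rfl fun b _ => ?_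
    have : ∀ y : Fin n ⊕ Fin m,
        ((if x = i then (1 : ℝ) else 0) - (if x = j then 1 else 0)) *
          ((if y = i then 1 else 0) - (if y = j then 1 else 0)) *
          ((net.unitVec i j).ofLp a * (net.unitVec i j).ofLp b) * u (y, b) =
        ((if x = i then (1 : ℝ) else 0) - (if x = j then 1 else 0)) *
          ((net.unitVec i j).ofLp a * (net.unitVec i j).ofLp b) *
          ((if y = i then u (y, b) else 0) - (if y = j then u (y, b) else 0)) := by
      intro y
      split_ifs <;> ring
    rw [Finset.sum_congr rfl fun y _ => this y, ← Finset.mul_sum, Finset.sum_sub_distrib]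
    simp only [Finset.sum_ite_eq', Finset.mem_univ, if_true]
    ring
  simp only [stiffnessMatrix, Matrix.smul_mulVec, Matrix.sum_mulVec, Pi.smul_apply,
    Finset.sum_apply, smul_eq_mul, h, mul_assoc]

theorem sum_stiffnessMatrix_mulVec (u : (Fin n ⊕ Fin m) × Fin d → ℝ) (a : Fin d) :
    ∑ x, (net.stiffnessMatrix.mulVec u) (x, a) = 0 := by
  simp only [stiffnessMatrix_mulVec, ← Finset.mul_sum]
  rw [Finset.sum_comm, Finset.sum_eq_zero, mul_zero]
  intro i _
  rw [Finset.sum_comm, Finset.sum_eq_zero]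
  intro j _
  rw [← Finset.mul_sum, ← Finset.sum_mul, Finset.sum_sub_distrib]
  simp

/-- The two forces of a spring are opposite and act along the line joining its ends, so their
torques cancel. -/
theorem sum_torque_stiffnessMatrix_mulVec (u : (Fin n ⊕ Fin m) × Fin d → ℝ) (a b : Fin d) :
    ∑ x, (net.pos x a * (net.stiffnessMatrix.mulVec u) (x, b) -
      net.pos x b * (net.stiffnessMatrix.mulVec u) (x, a)) = 0 := by
  have h : ∀ x, net.pos x a * (net.stiffnessMatrix.mulVec u) (x, b) -
      net.pos x b * (net.stiffnessMatrix.mulVec u) (x, a) = 1 / 2 * ∑ i, ∑ j,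
      (net.stiff i j * ∑ b, net.unitVec i j b * (u (i, b) - u (j, b))) *
        (((if x = i then net.pos x a else 0) - (if x = j then net.pos x a else 0)) *
          net.unitVec i j b -
         ((if x = i then net.pos x b else 0) - (if x = j then net.pos x b else 0)) *
          net.unitVec i j a) := by
    intro x
    rw [stiffnessMatrix_mulVec, stiffnessMatrix_mulVec, mul_left_comm, mul_left_comm (net.pos x b),
      ← mul_sub]
    congr 1
    rw [Finset.mul_sum, Finset.mul_sum, ← Finset.sum_sub_distrib]
    refine Finset.sum_congr rfl fun i _ => ?_
    rw [Finset.mul_sum, Finset.mul_sum, ← Finset.sum_sub_distrib]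
    refine Finset.sum_congr rfl fun j _ => ?_
    split_ifs <;> ring
  simp only [h, ← Finset.mul_sum]
  rw [Finset.sum_comm, Finset.sum_eq_zero, mul_zero]
  intro i _
  rw [Finset.sum_comm, Finset.sum_eq_zero]
  intro j _
  rw [← Finset.mul_sum, Finset.sum_sub_distrib, ← Finset.sum_mul, ← Finset.sum_mul]
  simp only [Finset.sum_sub_distrib, Finset.sum_ite_eq', Finset.mem_univ, if_true, unitVec,
    PiLp.smul_apply, PiLp.sub_apply, smul_eq_mul]
  ring

/-- For all displacements of the terminals, the forces `W u` are compatible with some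
displacements of the internal nodes at which there are no external forces. -/
def HasStaticForces (W : Matrix (Fin n × Fin d) (Fin n × Fin d) ℝ) : Prop :=
  ∀ u : Fin n × Fin d → ℝ, ∃ v : (Fin n ⊕ Fin m) × Fin d → ℝ,
    (∀ i a, v (Sum.inl i, a) = u (i, a)) ∧
    (∀ i a, (net.stiffnessMatrix.mulVec v) (Sum.inl i, a) = (W.mulVec u) (i, a)) ∧
    ∀ j a, (net.stiffnessMatrix.mulVec v) (Sum.inr j, a) = 0

/-- In the energy `v · K v` every term has a vanishing displacement or a vanishing force, and zero
energy means `K v = 0`. Hence floppy internal nodes do not affect terminal forces. -/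
theorem stiffnessMatrix_mulVec_eq_zero {v : (Fin n ⊕ Fin m) × Fin d → ℝ}
    (h : ∀ i a, v (Sum.inl i, a) = 0)
    (h' : ∀ j a, (net.stiffnessMatrix.mulVec v) (Sum.inr j, a) = 0) :
    net.stiffnessMatrix.mulVec v = 0 := by
  rw [← net.stiffnessMatrix_posSemidef.dotProduct_mulVec_zero_iff]
  refine Finset.sum_eq_zero ?_
  rintro ⟨i | j, a⟩ _
  · simp [h]
  · simp [h']

theorem map_ofReal_mulVec_re {ι : Type*} [Fintype ι] (A : Matrix ι ι ℝ) (z : ι → ℂ) (p : ι) :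
    ((A.map Complex.ofReal).mulVec z p).re = A.mulVec (fun q => (z q).re) p := by
  simp [Matrix.mulVec, dotProduct]

theorem map_ofReal_mulVec_im {ι : Type*} [Fintype ι] (A : Matrix ι ι ℝ) (z : ι → ℂ) (p : ι) :
    ((A.map Complex.ofReal).mulVec z p).im = A.mulVec (fun q => (z q).im) p := by
  simp [Matrix.mulVec, dotProduct]

theorem HasStaticForces.isResponseAt {net : DampedNetwork d n m}
    {W : Matrix (Fin n × Fin d) (Fin n × Fin d) ℝ} (hW : net.HasStaticForces W) {s c : ℂ}
    (hs : net.dynMatrix s = c • net.stiffnessMatrix.map Complex.ofReal) :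
    net.IsResponseAt s (c • W.map Complex.ofReal) := by
  intro u f
  obtain ⟨v₁, h₁, h₁', h₁''⟩ := hW fun p => (u p).re
  obtain ⟨v₂, h₂, h₂', h₂''⟩ := hW fun p => (u p).im
  -- As `K` is real, real and imaginary parts are solved separately.
  let w : Fin m × Fin d → ℂ := fun p => ⟨v₁ (Sum.inr p.1, p.2), v₂ (Sum.inr p.1, p.2)⟩
  have hw : (net.stiffnessMatrix.map Complex.ofReal).mulVec (joinNodes u w) =
      joinNodes ((W.map Complex.ofReal).mulVec u) 0 := by
    have hre : (fun q => (joinNodes u w q).re) = v₁ := by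
      ext ⟨i | j, a⟩ <;> simp [joinNodes, h₁, w]
    have him : (fun q => (joinNodes u w q).im) = v₂ := by
      ext ⟨i | j, a⟩ <;> simp [joinNodes, h₂, w]
    ext ⟨i | j, a⟩
    · apply Complex.ext
      · rw [map_ofReal_mulVec_re, hre, h₁']
        simp [joinNodes, map_ofReal_mulVec_re]
      · rw [map_ofReal_mulVec_im, him, h₂']
        simp [joinNodes, map_ofReal_mulVec_im]
    · apply Complex.ext
      · rw [map_ofReal_mulVec_re, hre, h₁'']
        simp [joinNodes]
      · rw [map_ofReal_mulVec_im, him, h₂'']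
        simp [joinNodes]
  have hsmul : ∀ g : Fin n × Fin d → ℂ,
      c • joinNodes g (0 : Fin m × Fin d → ℂ) = joinNodes (c • g) 0 := by
    intro g
    ext ⟨i | j, a⟩ <;> simp [joinNodes]
  rw [hs]
  constructor
  · rintro ⟨w', hw'⟩
    rw [Matrix.smul_mulVec] at hw' ⊢
    -- The factor `1 + αs` may vanish; then the dynamic matrix is zero and so is `f`.
    by_cases hc : c = 0
    · rw [hc, zero_smul] at hw' ⊢
      have : joinNodes (0 : Fin n × Fin d → ℂ) (0 : Fin m × Fin d → ℂ) = 0 := by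
        ext ⟨i | j, a⟩ <;> simp [joinNodes]
      rw [← this, joinNodes_inj] at hw'
      exact hw'.1.symm
    set z : (Fin n ⊕ Fin m) × Fin d → ℂ := joinNodes u w' - joinNodes u w with hz
    have hKz : c • (net.stiffnessMatrix.map Complex.ofReal).mulVec z =
        joinNodes (f - c • (W.map Complex.ofReal).mulVec u) 0 := by
      rw [hz, Matrix.mulVec_sub, smul_sub, hw', hw, hsmul]
      ext ⟨i | j, a⟩ <;> simp [joinNodes]
    have hz0 : ∀ i a, z (Sum.inl i, a) = 0 := fun i a => by simp [hz, joinNodes]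
    have hKz0 : ∀ j a, (net.stiffnessMatrix.map Complex.ofReal).mulVec z (Sum.inr j, a) = 0 := by
      intro j a
      have := congrFun hKz (Sum.inr j, a)
      simpa [joinNodes, hc] using this
    have hre := net.stiffnessMatrix_mulVec_eq_zero (v := fun q => (z q).re)
      (fun i a => by simp [hz0]) fun j a => by rw [← map_ofReal_mulVec_re, hKz0, Complex.zero_re]
    have him := net.stiffnessMatrix_mulVec_eq_zero (v := fun q => (z q).im)
      (fun i a => by simp [hz0]) fun j a => by rw [← map_ofReal_mulVec_im, hKz0, Complex.zero_im]
    have h0 : (net.stiffnessMatrix.map Complex.ofReal).mulVec z = 0 := by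
      ext p
      apply Complex.ext
      · rw [map_ofReal_mulVec_re, hre]; rfl
      · rw [map_ofReal_mulVec_im, him]; rfl
    rw [h0, smul_zero] at hKz
    ext ⟨i, a⟩
    have := congrFun hKz (Sum.inl i, a)
    simpa [joinNodes, sub_eq_zero] using this.symm
  · rintro rfl
    exact ⟨w, by rw [Matrix.smul_mulVec, hw, hsmul, Matrix.smul_mulVec]⟩

/-- The static response exists, also if the internal nodes are floppy. -/
theorem exists_hasStaticForces :
    ∃ W : Matrix (Fin n × Fin d) (Fin n × Fin d) ℝ, net.HasStaticForces W ∧ W.PosSemidef ∧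
      ∀ q, IsBalanced net.terminal (W.col q) := by
  set K := net.stiffnessMatrix with hK
  have hKps : K.PosSemidef := net.stiffnessMatrix_posSemidef
  have hsymm : K.transpose = K := by simpa using hKps.1.eq
  have hBapp : ∀ x y, Matrix.toBilin' K x y = x ⬝ᵥ K.mulVec y := fun x y =>
    Matrix.toBilin'_apply' K x y
  let j : (Fin m × Fin d → ℝ) →ₗ[ℝ] (Fin n ⊕ Fin m) × Fin d → ℝ :=
    { toFun := fun w p => Sum.elim (fun _ => 0) (fun j => w (j, p.2)) p.1
      map_add' := fun w w' => by ext ⟨i | i, a⟩ <;> simp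
      map_smul' := fun c w => by ext ⟨i | i, a⟩ <;> simp }
  have hBsymm : ∀ x y, Matrix.toBilin' K x y = Matrix.toBilin' K y x := fun x y => by
    rw [hBapp, hBapp, Matrix.dotProduct_mulVec, ← Matrix.mulVec_transpose, hsymm, dotProduct_comm]
  -- The equilibrium state for a unit displacement of one terminal coordinate; these states become
  -- the columns of `P`.
  have hex : ∀ q : Fin n × Fin d, ∃ v : (Fin n ⊕ Fin m) × Fin d → ℝ,
      (∀ i a, v (Sum.inl i, a) = if (i, a) = q then 1 else 0) ∧
      ∀ i a, (K.mulVec v) (Sum.inr i, a) = 0 := by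
    intro q
    let u : (Fin n ⊕ Fin m) × Fin d → ℝ := fun p =>
      Sum.elim (fun i => if (i, p.2) = q then 1 else 0) (fun _ => 0) p.1
    obtain ⟨w, hw⟩ := exists_stationary (Matrix.toBilin' K) hBsymm (fun x hx y => by
      rw [hBapp] at hx
      have : K.mulVec x = 0 := (hKps.dotProduct_mulVec_zero_iff x).1 (by simpa using hx)
      rw [hBsymm, hBapp, this, dotProduct_zero]) j u
    refine ⟨u + j w, fun i a => by simp [u, j], fun i a => ?_⟩
    have h1 := hw (Pi.single (i, a) 1)
    have h2 : j (Pi.single (i, a) 1) = Pi.single (Sum.inr i, a) 1 := by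
      ext ⟨i' | i', a'⟩ <;> simp [j, Pi.single_apply]
    rw [hBsymm, hBapp, h2, single_one_dotProduct] at h1
    exact h1
  choose v hv hv' using hex
  let P : Matrix ((Fin n ⊕ Fin m) × Fin d) (Fin n × Fin d) ℝ := Matrix.of fun p q => v q p
  have hKP : ∀ u, K.mulVec (P.mulVec u) = ∑ q, u q • K.mulVec (v q) := fun u => by
    have : P.mulVec u = ∑ q, u q • v q := by
      ext p
      simp [P, Matrix.mulVec, dotProduct, mul_comm]
    rw [this, Matrix.mulVec_sum]
    exact Finset.sum_congr rfl fun q _ => Matrix.mulVec_smul _ _ _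
  -- State `p` is a unit vector at the terminals and state `q` has no internal forces, so the mutual
  -- energy is one terminal force.
  have hPKP : ∀ p q, (P.conjTranspose * K * P) p q = K.mulVec (v q) (Sum.inl p.1, p.2) := by
    intro p q
    have : (P.conjTranspose * K * P) p q = v p ⬝ᵥ K.mulVec (v q) := by
      rw [Matrix.mul_assoc, Matrix.mul_apply]
      rfl
    rw [this, dotProduct, Fintype.sum_prod_type, Fintype.sum_sum_type]
    simp only [hv, hv', mul_zero, Finset.sum_const_zero, add_zero, ite_mul, one_mul, zero_mul]
    rw [← Fintype.sum_prod_type' (f := fun i a => if (i, a) = p then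
      K.mulVec (v q) (Sum.inl i, a) else 0)]
    simp
  refine ⟨P.conjTranspose * K * P, fun u => ⟨P.mulVec u, fun i a => ?_, fun i a => ?_,
    fun i a => ?_⟩, hKps.conjTranspose_mul_mul_same P, fun q => ⟨fun a => ?_, fun a b => ?_⟩⟩
  · simp [P, Matrix.mulVec, dotProduct, hv]
  · rw [← hK, hKP]
    change (∑ q, u q • K.mulVec (v q)) (Sum.inl i, a) =
      ∑ q, (P.conjTranspose * K * P) (i, a) q * u q
    simp only [hPKP, Finset.sum_apply, Pi.smul_apply, smul_eq_mul, mul_comm]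
  · rw [← hK, hKP]
    simp [hv']
  · simp only [Matrix.col_apply, hPKP]
    have := net.sum_stiffnessMatrix_mulVec (v q) a
    rw [Fintype.sum_sum_type] at this
    simpa [← hK, hv'] using this
  · simp only [Matrix.col_apply, hPKP, terminal]
    have := net.sum_torque_stiffnessMatrix_mulVec (v q) a b
    rw [Fintype.sum_sum_type] at this
    simpa [← hK, hv'] using this

end DampedNetwork

/-! ### Factorisation of `W` and assembly of the network -/

section Assembly

open scoped RealInnerProductSpace

theorem inner_euclidean {d : ℕ} (x y : EuclideanSpace ℝ (Fin d)) : ⟪x, y⟫ = ∑ a, x a * y a := by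
  simp [PiLp.inner_apply, mul_comm]

/-- The work is the pairing of the antisymmetric matrix of `A` with the moment matrix of the forces,
which is symmetric as the torques vanish. -/
theorem sum_inner_eq_zero_of_isBalanced {d n : ℕ} {x : Fin n → EuclideanSpace ℝ (Fin d)}
    {g : Fin n × Fin d → ℝ} (hg : IsBalanced x g)
    {A : EuclideanSpace ℝ (Fin d) →ₗ[ℝ] EuclideanSpace ℝ (Fin d)} (hA : ∀ x, ⟪A x, x⟫ = 0) :
    ∑ i, ⟪A (x i), WithLp.toLp 2 fun a => g (i, a)⟫ = 0 := by
  let b := EuclideanSpace.basisFun (Fin d) ℝ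
  have hskew : ∀ y z, ⟪A y, z⟫ + ⟪A z, y⟫ = 0 := fun y z => by
    have := hA (y + z)
    simp only [map_add, inner_add_left, inner_add_right, hA] at this
    linarith
  have hx : ∀ i c, ⟪A (x i), b c⟫ = ∑ a, x i a * ⟪A (b a), b c⟫ := fun i c => by
    conv_lhs => rw [← b.sum_repr (x i)]
    simp [sum_inner, real_inner_smul_left, b]
  have hy : ∀ i, ⟪A (x i), WithLp.toLp 2 fun a => g (i, a)⟫ =
      ∑ c, ∑ a, ⟪A (b a), b c⟫ * (x i a * g (i, c)) := fun i => by
    rw [inner_euclidean]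
    refine Finset.sum_congr rfl fun c _ => ?_
    have : (A (x i)) c = ⟪A (x i), b c⟫ := by simp [b, EuclideanSpace.inner_single_right]
    rw [this, hx, Finset.sum_mul]
    exact Finset.sum_congr rfl fun a _ => by ring
  have h1 : ∑ i, ⟪A (x i), WithLp.toLp 2 fun a => g (i, a)⟫ =
      ∑ c, ∑ a, ⟪A (b a), b c⟫ * ∑ i, x i a * g (i, c) := by
    simp only [hy, Finset.mul_sum]
    rw [Finset.sum_comm]
    exact Finset.sum_congr rfl fun c _ => Finset.sum_comm
  have h2 : ∑ i, ⟪A (x i), WithLp.toLp 2 fun a => g (i, a)⟫ =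
      -∑ c, ∑ a, ⟪A (b a), b c⟫ * ∑ i, x i a * g (i, c) := by
    rw [h1]
    conv_lhs => rw [Finset.sum_comm]
    rw [← Finset.sum_neg_distrib]
    refine Finset.sum_congr rfl fun c _ => ?_
    rw [← Finset.sum_neg_distrib]
    refine Finset.sum_congr rfl fun a _ => ?_
    have h3 : ∑ i, x i c * g (i, a) = ∑ i, x i a * g (i, c) := by
      have := hg.2 c a
      rw [Finset.sum_sub_distrib] at this
      linarith
    have h4 : ⟪A (b c), b a⟫ = -⟪A (b a), b c⟫ := by linarith [hskew (b c) (b a)]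
    rw [h3, h4, neg_mul]
  linarith

/-- The field of the forces `(g (i, a))ₐ` at the points `x i`. -/
def forceField {d n : ℕ} (x : Fin n → EuclideanSpace ℝ (Fin d)) (g : Fin n × Fin d → ℝ) :
    EuclideanSpace ℝ (Fin d) → EuclideanSpace ℝ (Fin d) :=
  Function.extend x (fun i => WithLp.toLp 2 fun a => g (i, a)) 0

theorem forceField_apply {d n : ℕ} {x : Fin n → EuclideanSpace ℝ (Fin d)}
    (hx : Function.Injective x) (g : Fin n × Fin d → ℝ) (i : Fin n) :
    forceField x g (x i) = WithLp.toLp 2 fun a => g (i, a) := hx.extend_apply _ _ _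

theorem forceField_apply_of_notMem {d n : ℕ} {x : Fin n → EuclideanSpace ℝ (Fin d)}
    (g : Fin n × Fin d → ℝ) {z : EuclideanSpace ℝ (Fin d)} (hz : z ∉ Set.range x) :
    forceField x g z = 0 := Function.extend_apply' _ _ _ hz

theorem IsBalanced.isSynthesizable {d n : ℕ} (hd : 2 ≤ d)
    {x : Fin n → EuclideanSpace ℝ (Fin d)} (hx : Function.Injective x)
    {g : Fin n × Fin d → ℝ} (hg : IsBalanced x g) {U : Set (EuclideanSpace ℝ (Fin d))}
    (hU : IsOpen U) (hUc : Convex ℝ U) (hxU : ∀ i, x i ∈ U) :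
    IsSynthesizable U (Finset.univ.map ⟨x, hx⟩) fun u =>
      (∑ i, ⟪WithLp.toLp 2 fun a => g (i, a), u (x i)⟫) • forceField x g := by
  have h := (isSupportable_of_balanced (V := EuclideanSpace ℝ (Fin d)) (by simpa using hd) hU hUc
    (T := Finset.univ.map ⟨x, hx⟩) (by rintro z hz; simp at hz; obtain ⟨i, rfl⟩ := hz; exact hxU i)
    (g := forceField x g) (fun z hz => forceField_apply_of_notMem g (by simpa using hz)) ?_
    fun A hA => ?_).isSynthesizable
  · simpa [forceField_apply hx] using h
  · simp only [Finset.sum_map, Function.Embedding.coeFn_mk, forceField_apply hx]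
    ext a
    simpa using hg.1 a
  · simp only [Finset.sum_map, Function.Embedding.coeFn_mk, forceField_apply hx]
    exact sum_inner_eq_zero_of_isBalanced hg hA

/-- `GᵀG` and `G` have the same kernel, so a vector orthogonal to all columns of `GᵀG` is orthogonal
to all rows of `G`. -/
theorem isBalanced_row_of_conjTranspose_mul_self {ι : Type*} [Fintype ι] {d n : ℕ}
    {x : Fin n → EuclideanSpace ℝ (Fin d)} {G : Matrix ι (Fin n × Fin d) ℝ}
    (h : ∀ q, IsBalanced x ((G.conjTranspose * G).col q)) (q : ι) :
    IsBalanced x (G.row q) := by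
  -- balanced systems of forces are those orthogonal to certain vectors
  have key : ∀ l : Fin n × Fin d → ℝ,
      (∀ p, ∑ i, ∑ a, l (i, a) * (G.conjTranspose * G) (i, a) p = 0) →
      ∑ i, ∑ a, l (i, a) * G q (i, a) = 0 := by
    intro l hl
    have h1 : (G.conjTranspose * G).mulVec l = 0 := by
      ext p
      rw [← (Matrix.isHermitian_conjTranspose_mul_self G).eq, Pi.zero_apply, ← hl p]
      simp [Matrix.mulVec, dotProduct, Fintype.sum_prod_type, mul_comm]
    have h2 := congrFun ((Matrix.conjTranspose_mul_self_mulVec_eq_zero G l).1 h1) q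
    simpa [Matrix.mulVec, dotProduct, Fintype.sum_prod_type, mul_comm] using h2
  refine ⟨fun a => ?_, fun a b => ?_⟩
  · have := key (fun p => if p.2 = a then 1 else 0) fun p => by simpa using (h p).1 a
    simpa using this
  · have := key (fun p => (if p.2 = b then x p.1 a else 0) - (if p.2 = a then x p.1 b else 0))
      fun p => by
        have := (h p).2 a b
        simpa [sub_mul, Finset.sum_sub_distrib] using this
    simpa [sub_mul, Finset.sum_sub_distrib] using this

namespace DampedNetwork

/-- The massless network with proportional damping whose springs are given by the function `k` of
the positions of their end points. -/
def ofStiffness {d n m : ℕ} (pos : Fin n ⊕ Fin m → EuclideanSpace ℝ (Fin d))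
    (hpos : Function.Injective pos)
    (k : EuclideanSpace ℝ (Fin d) → EuclideanSpace ℝ (Fin d) → ℝ)
    (hk : ∀ p q, k p q = k q p) (hk' : ∀ p q, 0 ≤ k p q) (α : ℝ) (hα : 0 ≤ α) :
    DampedNetwork d n m where
  pos := pos
  pos_injective := hpos
  stiff i j := k (pos i) (pos j) * ‖pos i - pos j‖ ^ 2
  stiff_symm i j := by rw [hk, norm_sub_rev]
  stiff_nonneg i j := mul_nonneg (hk' _ _) (sq_nonneg _)
  damp i j := α * (k (pos i) (pos j) * ‖pos i - pos j‖ ^ 2)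
  damp_symm i j := by rw [hk, norm_sub_rev]
  damp_nonneg i j := mul_nonneg hα (mul_nonneg (hk' _ _) (sq_nonneg _))
  visc _ := 0
  visc_nonneg _ := le_rfl
  mass _ := 0
  mass_nonneg _ := le_rfl

theorem isRayleigh_of_damp_eq {d n m : ℕ} {net : DampedNetwork d n m} {α : ℝ} (β : ℝ)
    (h : ∀ i j, net.damp i j = α * net.stiff i j) (hv : ∀ i, net.visc i = 0)
    (hm : net.IsMassless) : net.IsRayleigh α β := by
  have hv' : (Matrix.diagonal fun p => net.visc p.1 :
      Matrix ((Fin n ⊕ Fin m) × Fin d) ((Fin n ⊕ Fin m) × Fin d) ℝ) = 0 := by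
    ext p q
    simp [Matrix.diagonal_apply, hv]
  rw [IsRayleigh, net.massMatrix_eq_zero hm, dampingMatrix, stiffnessMatrix, hv', smul_zero,
    add_zero, add_zero, smul_comm α]
  simp only [h, mul_smul, Finset.smul_sum]

/-- The factor `‖pos i - pos j‖ ^ 2` in the stiffness offsets the two normalisations in `nᵢⱼ nᵢⱼᵀ`,
since `networkForce` uses unnormalised differences. -/
theorem ofStiffness_mulVec {d n m : ℕ} {pos : Fin n ⊕ Fin m → EuclideanSpace ℝ (Fin d)}
    (hpos : Function.Injective pos)
    {k : EuclideanSpace ℝ (Fin d) → EuclideanSpace ℝ (Fin d) → ℝ}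
    (hk : ∀ p q, k p q = k q p) (hk' : ∀ p q, 0 ≤ k p q) {α : ℝ} (hα : 0 ≤ α)
    (w : EuclideanSpace ℝ (Fin d) → EuclideanSpace ℝ (Fin d)) (l : Fin n ⊕ Fin m) (a : Fin d) :
    ((ofStiffness pos hpos k hk hk' α hα).stiffnessMatrix.mulVec fun p => w (pos p.1) p.2) (l, a) =
      networkForce (Finset.univ.map ⟨pos, hpos⟩) k w (pos l) a := by
  rw [stiffnessMatrix_mulVec, networkForce]
  simp only [Finset.sum_map, Function.Embedding.coeFn_mk, Pi.smul_apply, Finset.sum_apply,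
    PiLp.smul_apply, smul_eq_mul, WithLp.ofLp_sum]
  congr 1
  refine Finset.sum_congr rfl fun i _ => Finset.sum_congr rfl fun j _ => ?_
  rcases eq_or_ne i j with rfl | hij
  · simp [springForce]
  have h0 : ‖pos i - pos j‖ ≠ 0 := norm_ne_zero_iff.2 (sub_ne_zero.2 (hpos.ne hij))
  have h1 : springForce (pos i) (pos j) (pos l) a =
      ((if l = i then 1 else 0) - (if l = j then 1 else 0)) * (pos i - pos j) a := by
    rw [springForce_eq_of_sub rfl]
    by_cases hi : l = i
    · subst hi
      simp [hij, hpos.ne hij]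
    · by_cases hj : l = j
      · subst hj
        simp [hi, hpos.ne hi]
      · simp [hi, hj, hpos.ne hi, hpos.ne hj]
  have h2 : ∑ b, (ofStiffness pos hpos k hk hk' α hα).unitVec i j b *
      (w (pos i) b - w (pos j) b) = ‖pos i - pos j‖⁻¹ * elongation (pos i) (pos j) w := by
    rw [elongation_apply, inner_euclidean, Finset.mul_sum]
    refine Finset.sum_congr rfl fun b _ => ?_
    simp only [unitVec, ofStiffness, PiLp.smul_apply, PiLp.sub_apply, smul_eq_mul]
    ring
  rw [h1, h2]
  simp only [unitVec, ofStiffness, PiLp.smul_apply, smul_eq_mul]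
  field_simp

end DampedNetwork

open DampedNetwork in
/-- The synthesis of a given response. -/
theorem exists_network_of_posSemidef {d n : ℕ} (hd : 2 ≤ d)
    {x : Fin n → EuclideanSpace ℝ (Fin d)} (hx : Function.Injective x) {α : ℝ} (β : ℝ)
    (hα : 0 ≤ α) {W : Matrix (Fin n × Fin d) (Fin n × Fin d) ℝ} (hW : W.PosSemidef)
    (hWb : ∀ q, IsBalanced x (W.col q)) {S U : Set (EuclideanSpace ℝ (Fin d))} (hS : S.Finite)
    (hU : IsOpen U) (hUc : Convex ℝ U) (hxU : ∀ i, x i ∈ U) :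
    ∃ (m : ℕ) (net : DampedNetwork d n m), net.terminal = x ∧ net.IsMassless ∧
      net.IsRayleigh α β ∧ (∀ i j, net.damp i j = α * net.stiff i j) ∧
      net.HasStaticForces W ∧ ∀ j, net.internal j ∈ U \ S := by
  classical
  obtain ⟨r, G, rfl⟩ : ∃ (r : ℕ) (G : Matrix (Fin r) (Fin n × Fin d) ℝ),
      W = G.conjTranspose * G := by
    obtain ⟨r, v, hv⟩ := Matrix.posSemidef_iff_eq_sum_vecMulVec.1 hW
    refine ⟨r, Matrix.of v, hv.trans ?_⟩
    ext p q
    simp [Matrix.mul_apply, Matrix.sum_apply, Matrix.vecMulVec_apply]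
  have hG := isBalanced_row_of_conjTranspose_mul_self hWb
  obtain ⟨N, k, hTN, hN, hk, hk', -, hR⟩ := isSynthesizable_sum Finset.univ
    (fun q _ => (hG q).isSynthesizable hd hx hU hUc hxU) S hS
  set T : Finset (EuclideanSpace ℝ (Fin d)) := Finset.univ.map ⟨x, hx⟩ with hT
  let e : Fin (N \ T).card ≃ {z // z ∈ N \ T} := (N \ T).equivFin.symm
  have heT : ∀ j, (e j : EuclideanSpace ℝ (Fin d)) ∉ T := fun j => (Finset.mem_sdiff.1 (e j).2).2
  have hxT : ∀ i, x i ∈ T := fun i => by simp [hT]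
  let pos : Fin n ⊕ Fin (N \ T).card → EuclideanSpace ℝ (Fin d) := Sum.elim x fun j => e j
  have hpos : Function.Injective pos := by
    refine hx.sumElim (Subtype.val_injective.comp e.injective) fun i j h => heT j ?_
    rw [← h]
    exact hxT i
  have hposN : Finset.univ.map ⟨pos, hpos⟩ = N := by
    ext z
    simp only [Finset.mem_map, Finset.mem_univ, true_and, Function.Embedding.coeFn_mk]
    constructor
    · rintro ⟨i | j, rfl⟩
      · exact hTN (hxT i)
      · exact (Finset.mem_sdiff.1 (e j).2).1
    · intro hz
      by_cases hzT : z ∈ T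
      · obtain ⟨i, -, rfl⟩ := Finset.mem_map.1 hzT
        exact ⟨Sum.inl i, rfl⟩
      · exact ⟨Sum.inr (e.symm ⟨z, Finset.mem_sdiff.2 ⟨hz, hzT⟩⟩), by simp [pos]⟩
  have hdamp : ∀ i j, (ofStiffness pos hpos k hk hk' α hα).damp i j =
    α * (ofStiffness pos hpos k hk hk' α hα).stiff i j := fun _ _ => rfl
  refine ⟨_, ofStiffness pos hpos k hk hk' α hα, rfl, fun _ => rfl,
    isRayleigh_of_damp_eq β hdamp (fun _ => rfl) fun _ => rfl, hdamp, fun u => ?_, fun j => ?_⟩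
  · obtain ⟨w, hw, hf⟩ := hR (forceField x u)
    have hwx : ∀ i a, w (x i) a = u (i, a) := fun i a => by
      rw [hw _ (hxT i), forceField_apply hx]
    refine ⟨fun p => w (pos p.1) p.2, fun i a => hwx i a, fun i a => ?_, fun j a => ?_⟩
    · rw [ofStiffness_mulVec, hposN, hf]
      -- The superposed forces are the sum of `(G_q · u) G_q` over the rows of `G`, which is `GᵀG
      -- u`.
      change (∑ q, (∑ i, ⟪WithLp.toLp 2 fun a => G.row q (i, a), forceField x u (x i)⟫) •
        forceField x (G.row q)) (x i) a = _
      rw [← Matrix.mulVec_mulVec]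
      simp only [Finset.sum_apply, Pi.smul_apply, forceField_apply hx, WithLp.ofLp_sum,
        PiLp.smul_apply, inner_euclidean, Matrix.row_apply, smul_eq_mul]
      simp [Matrix.mulVec, dotProduct, Fintype.sum_prod_type, mul_comm]
    · rw [ofStiffness_mulVec, hposN, hf]
      have : pos (Sum.inr j) ∉ Set.range x := by
        rintro ⟨i, hi⟩
        exact Sum.inl_ne_inr (hpos (show pos (Sum.inl i) = pos (Sum.inr j) from hi))
      simp [forceField_apply_of_notMem _ this]
  · exact hN _ (Finset.mem_sdiff.1 (e j).2).1 (heT j)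

end Assembly

end

theorem theorem3p2 {d : ℕ} (hd : d = 2 ∨ d = 3) {n : ℕ}
    (x : Fin n → EuclideanSpace ℝ (Fin d)) (hx : Function.Injective x)
    (α β : ℝ) (hα : 0 ≤ α) (hβ : 0 ≤ β) :
    (∀ (m : ℕ) (net : DampedNetwork d n m),
      net.terminal = x → net.IsMassless → net.IsRayleigh α β →
      ∃ W : Matrix (Fin n × Fin d) (Fin n × Fin d) ℝ,
        IsStaticResponse x W ∧ W.PosSemidef ∧ (∀ q, IsBalanced x (W.col q)) ∧
        net.HasResponse fun s => (1 + (α : ℂ) * s) • W.map Complex.ofReal) ∧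
    (∀ W : Matrix (Fin n × Fin d) (Fin n × Fin d) ℝ,
      W.PosSemidef → (∀ q, IsBalanced x (W.col q)) →
      ∀ S : Set (EuclideanSpace ℝ (Fin d)), S.Finite → ∀ ε : ℝ, 0 < ε →
      ∃ (m : ℕ) (net : DampedNetwork d n m),
        net.terminal = x ∧ net.IsMassless ∧ net.IsRayleigh α β ∧
        (∀ i j, net.damp i j = α * net.stiff i j) ∧
        (net.HasResponse fun s => (1 + (α : ℂ) * s) • W.map Complex.ofReal) ∧
        ∀ j, net.internal j ∉ S ∧
          net.internal j ∈ Metric.thickening ε (convexHull ℝ (Set.range x))) := by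
  refine ⟨fun m net hnet hm hr => ?_, fun W hW hWb S hS ε hε => ?_⟩
  · obtain ⟨W, hW, hps, hb⟩ := net.exists_hasStaticForces
    -- The springs of `net` alone. Static forces depend only on positions and springs, so `W` serves
    -- both networks; Rayleigh constants `0, 0` make the factor `1`.
    let net' : DampedNetwork d n m := { net with
      damp := fun _ _ => 0
      damp_symm := fun _ _ => rfl
      damp_nonneg := fun _ _ => le_rfl
      visc := fun _ => 0
      visc_nonneg := fun _ => le_rfl
      mass := fun _ => 0
      mass_nonneg := fun _ => le_rfl }
    have hm' : net'.IsMassless := fun _ => rfl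
    have hr' : net'.IsRayleigh 0 0 := DampedNetwork.isRayleigh_of_damp_eq 0
      (fun _ _ => (zero_mul _).symm) (fun _ => rfl) hm'
    have hW' : net'.HasStaticForces W := hW
    refine ⟨W, ⟨m, net', hnet, ⟨fun _ _ => rfl, fun _ => rfl, hm'⟩, fun s => ?_⟩, hps, hnet ▸ hb,
      fun s => hW.isResponseAt (net.dynMatrix_eq hm hr s)⟩
    have h := hW'.isResponseAt (net'.dynMatrix_eq hm' hr' s)
    simpa using h
  · have hxU : ∀ i, x i ∈ Metric.thickening ε (convexHull ℝ (Set.range x)) := fun i =>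
      Metric.self_subset_thickening hε _ (subset_convexHull ℝ _ (Set.mem_range_self i))
    obtain ⟨m, net, h1, h2, h3, h4, h5, h6⟩ := exists_network_of_posSemidef (by omega) hx β hα hW
      hWb hS Metric.isOpen_thickening ((convex_convexHull ℝ _).thickening ε) hxU
    exact ⟨m, net, h1, h2, h3, h4, fun s => h5.isResponseAt (net.dynMatrix_eq h2 h3 s),
      fun j => ⟨(h6 j).2, (h6 j).1⟩⟩
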